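/- Call an integer $D>9$ with $D\equiv 0,1,4 \pmod 8$ a *$(1,2)$-primitive discriminant* if there are no integers $f>1$ and $D'\equiv 0,1,4\pmod 8$ with $D=f^2D'$. For elliptic curves $E_1,E_2$, equip the abelian surface $E_1\times E_2$ with the $(1,2)$-polarization given on $H_1(E_1\times E_2,\mathbb{Z})=H_1(E_1,\mathbb{Z})\times H_1(E_2,\mathbb{Z})$ by $\langle\cdot,\cdot\rangle_1+2\langle\cdot,\cdot\rangle_2$, where $\langle\cdot,\cdot\rangle_i$ is the intersection form of $E_i$. A *real multiplication* on it by the quadratic order $\mathcal{O}_D$ of discriminant $D$ is an injective ring homomorphism $\rho:\mathcal{O}_D\to \mathrm{End}(E_1\times E_2)$ whose image consists of endomorphisms that are self-adjoint with respect to the polarization and which is proper: if $T\in\mathrm{End}(E_1\times E_2)$ and $nT\in\rho(\mathcal{O}_D)$ for some nonzero integer $n$, then $T\in\rho(\mathcal{O}_D)$. Let $\Omega Q'_D$ be the space of isomorphism classes of pairs $((E_1,\omega_1),(E_2,\omega_2))$ of elliptic curves with nonzero holomorphic one-forms such that $E_1\times E_2$ has a real multiplication by $\mathcal{O}_D$ for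 which $\omega_1+\omega_2$ is an eigenform, and let $Q'_D=\Omega Q'_D/\mathbb{C}^*$. The space $\Omega Q'_D$ is a union of $\mathrm{GL}^+(2,\mathbb{R})$-orbits, and the quotient by $\mathbb{C}^*$ of the orbit of a point with stabilizer $\Gamma$ is $\mathbb{H}/\Gamma$. Let $\chi(Q'_D)$ be the orbifold Euler characteristic of $Q'_D$, i.e. the sum over its components $\mathbb{H}/\Gamma$ of $\chi(\mathbb{H}/\Gamma)=-\frac{1}{2\pi}\int_{\mathbb{H}/\Gamma}\frac{dx\,dy}{y^2}$, where elements of $\Gamma$ that act trivially on $\mathbb{H}$ are disregarded. **Proposition.** Let $D_0>9$ be a $(1,2)$-primitive discriminant and let $f\geq 1$ be an integer. Then for every $r\mid f$ the curve $Q'_{r^2D_0}$ has finitely many components, each of finite area, and $$\sum_{r\mid f}\chi(Q'_{r^2D_0})=-\frac16\sum_{\substack{e\in\mathbb{Z},\; e^2<f^2D_0\\ e^2\equiv f^2D_0\ (\mathrm{mod}\ 8)}}\sigma_1\!\left(\frac{f^2D_0-e^2}{8}\right),$$ where $r$ runs over the positive divisors of $f$ and $\sigma_1(n)=\sum_{d\mid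 n}d$. -/

import Mathlib

open MeasureTheory UpperHalfPlane
open scoped MatrixGroups ComplexConjugate

noncomputable section

namespace PrymEigenform

/-! ## Lattices in `ℂ` and the action of `GL⁺(2, ℝ)` -/

/-- A lattice in `ℂ`.  The lattice `L` stands for the elliptic curve with a nonzero holomorphic
one-form `(ℂ / L, dz)`; up to isomorphism every pair (elliptic curve, nonzero holomorphic one-form)
is of this form for exactly one lattice, its lattice of periods. -/
@[ext]
structure PlaneLattice where
  /-- The underlying subgroup of `ℂ`. -/
  carrier : Submodule ℤ ℂ
  discrete : DiscreteTopology carrier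
  isLattice : IsZLattice ℝ carrier

/-- The `ℝ`-linear map `x + i y ↦ (a x + b y) + i (c x + d y)` of `ℂ = ℝ²` given by the matrix
`(a, b; c, d)`. -/
def planeLin (g : GL (Fin 2) ℝ) : ℂ →ₗ[ℝ] ℂ :=
  Matrix.toLin Complex.basisOneI Complex.basisOneI (g : Matrix (Fin 2) (Fin 2) ℝ)

theorem planeLin_one : planeLin 1 = LinearMap.id := by
  simp [planeLin]

theorem planeLin_mul (g h : GL (Fin 2) ℝ) : planeLin (g * h) = planeLin g ∘ₗ planeLin h := by
  simp only [planeLin, Units.val_mul]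
  exact Matrix.toLin_mul _ _ _ _ _

/-- `planeLin g` as an equivalence. -/
def planeEquiv (g : GL (Fin 2) ℝ) : ℂ ≃L[ℝ] ℂ :=
  (LinearEquiv.ofLinearMap (planeLin g) (planeLin g⁻¹)
    (by rw [← planeLin_mul, mul_inv_cancel, planeLin_one])
    (by rw [← planeLin_mul, inv_mul_cancel, planeLin_one])).toContinuousLinearEquiv

theorem map_eq_comap (g : GL (Fin 2) ℝ) (L : Submodule ℤ ℂ) :
    L.map ((planeLin g).restrictScalars ℤ) =
      ZLattice.comap ℝ L (planeEquiv g).symm.toLinearMap := by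
  ext z
  constructor
  · rintro ⟨w, hw, rfl⟩
    have h : (planeEquiv g).symm (planeEquiv g w) ∈ L := by
      rw [ContinuousLinearEquiv.symm_apply_apply]; exact hw
    exact h
  · intro hz
    exact ⟨(planeEquiv g).symm z, hz, (planeEquiv g).apply_symm_apply z⟩

instance : SMul (GL (Fin 2) ℝ) PlaneLattice where
  smul g L :=
    { carrier := L.carrier.map ((planeLin g).restrictScalars ℤ)
      discrete := by
        have := L.discrete
        rw [map_eq_comap]
        infer_instance
      isLattice := by
        have h1 := L.discrete
        have h2 := L.isLattice
        have h3 : DiscreteTopology (L.carrier.map ((planeLin g).restrictScalars ℤ)) := by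
          rw [map_eq_comap]; infer_instance
        refine ⟨?_⟩
        rw [map_eq_comap]
        exact (instIsZLatticeComap ℝ L.carrier (planeEquiv g).symm).span_top }

theorem smul_carrier (g : GL (Fin 2) ℝ) (L : PlaneLattice) :
    (g • L).carrier = L.carrier.map ((planeLin g).restrictScalars ℤ) := rfl

/-- The action of `GL(2, ℝ)` on lattices, `g • L = g(L)`.  The subgroup `GL(2, ℝ)⁺` acts on
lattices by restriction, and diagonally on pairs of lattices. -/
instance : MulAction (GL (Fin 2) ℝ) PlaneLattice where
  one_smul L := by
    ext z
    simp [smul_carrier, planeLin_one]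
  mul_smul g h L := by
    ext z
    simp [smul_carrier, planeLin_mul]

/-! ## The abelian surface `E₁ × E₂` with its `(1, 2)`-polarization -/

/-- The first homology `Λ₁ × Λ₂ ⊆ ℂ × ℂ` of the abelian surface `A = ℂ / Λ₁ × ℂ / Λ₂`. -/
def periodLattice (p : PlaneLattice × PlaneLattice) : Submodule ℤ (ℂ × ℂ) :=
  p.1.carrier.prod p.2.carrier

/-- The endomorphism ring of the abelian surface `A = ℂ / Λ₁ × ℂ / Λ₂`: the `ℂ`-linear maps of
`ℂ × ℂ` that map `Λ₁ × Λ₂` into itself. -/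
def endRing (p : PlaneLattice × PlaneLattice) : Subring (Module.End ℂ (ℂ × ℂ)) where
  carrier := {T | ∀ v ∈ periodLattice p, T v ∈ periodLattice p}
  mul_mem' hS hT v hv := hS _ (hT v hv)
  one_mem' _ hv := hv
  add_mem' hS hT v hv := (periodLattice p).add_mem (hS v hv) (hT v hv)
  zero_mem' _ _ := (periodLattice p).zero_mem
  neg_mem' hT v hv := (periodLattice p).neg_mem (hT v hv)

/-- The intersection form on `H₁(ℂ / L, ℤ) = L`: the `ℤ`-valued alternating form on `L` with value
`1` on every positively oriented basis of `L`. -/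
def intersectionForm (L : PlaneLattice) (x y : ℂ) : ℝ :=
  (conj x * y).im / ZLattice.covolume L.carrier

/-- The polarization `⟨·,·⟩₁ + 2 ⟨·,·⟩₂` of type `(1, 2)` on `H₁(A, ℤ) = Λ₁ × Λ₂`. -/
def polarization (p : PlaneLattice × PlaneLattice) (v w : ℂ × ℂ) : ℝ :=
  intersectionForm p.1 v.1 w.1 + 2 * intersectionForm p.2 v.2 w.2

/-! ## Real multiplication and the eigenform locus -/

/-- The quadratic order `𝒪_D` of discriminant `D`, for `D ≡ 0, 1` modulo `4`:  it is
`ℤ[x] / (x² - b x - a)` with `b ∈ {0, 1}`, `b ≡ D` modulo `2`, and `b² + 4 a = D`. -/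
abbrev QuadOrder (D : ℕ) : Type :=
  QuadraticAlgebra ℤ (((D / 4 : ℕ) : ℤ)) (((D % 2 : ℕ) : ℤ))

/-- `ρ : 𝒪_D → End(A)` is a real multiplication by `𝒪_D` on `A = ℂ / Λ₁ × ℂ / Λ₂` equipped with its
`(1, 2)`-polarization: `ρ` is faithful, self-adjoint and proper. -/
structure IsRealMultiplication {D : ℕ} {p : PlaneLattice × PlaneLattice}
    (ρ : QuadOrder D →+* endRing p) : Prop where
  faithful : Function.Injective ρ
  selfAdjoint : ∀ x : QuadOrder D, ∀ v ∈ periodLattice p, ∀ w ∈ periodLattice p,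
    polarization p ((ρ x : Module.End ℂ (ℂ × ℂ)) v) w =
      polarization p v ((ρ x : Module.End ℂ (ℂ × ℂ)) w)
  proper : ∀ (T : endRing p) (n : ℤ), n ≠ 0 → n • T ∈ ρ.range → T ∈ ρ.range

/-- The holomorphic one-form `dz₁ + dz₂` on `ℂ / Λ₁ × ℂ / Λ₂`, as a linear form on `ℂ × ℂ`. -/
def oneForm : (ℂ × ℂ) →ₗ[ℂ] ℂ := LinearMap.fst ℂ ℂ ℂ + LinearMap.snd ℂ ℂ ℂ

/-- `dz₁ + dz₂` is an eigenform for `ρ`: for all `x`, the pullback `ρ(x)^*(dz₁ + dz₂)` is a multiple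
of `dz₁ + dz₂`. -/
def IsEigenform {D : ℕ} {p : PlaneLattice × PlaneLattice} (ρ : QuadOrder D →+* endRing p) : Prop :=
  ∀ x : QuadOrder D, ∃ c : ℂ, oneForm ∘ₗ (ρ x : Module.End ℂ (ℂ × ℂ)) = c • oneForm

/-- The space `ΩQ'_D` of pairs `((E₁, ω₁), (E₂, ω₂)) = ((ℂ / Λ₁, dz), (ℂ / Λ₂, dz))` such that
`E₁ × E₂`, with its `(1, 2)`-polarization, has a real multiplication by `𝒪_D` for which `ω₁ + ω₂`
is an eigenform. -/
def OmegaQPrime (D : ℕ) : Set (PlaneLattice × PlaneLattice) :=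
  {p | ∃ ρ : QuadOrder D →+* endRing p, IsRealMultiplication ρ ∧ IsEigenform ρ}

/-! ## The curve `Q'_D = ΩQ'_D / ℂ^*` and its orbifold Euler characteristic -/

/-- Multiplication by `c ∈ ℂ^*` as an element of `GL⁺(2, ℝ)`. -/
def scalarGL (c : ℂˣ) : GL(2, ℝ)⁺ :=
  ⟨Matrix.GeneralLinearGroup.mkOfDetNeZero !![(c : ℂ).re, -(c : ℂ).im; (c : ℂ).im, (c : ℂ).re]
    (by
      have h := Complex.normSq_pos.mpr c.ne_zero
      rw [Complex.normSq_apply] at h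
      rw [Matrix.det_fin_two_of]
      nlinarith), by
    have h := Complex.normSq_pos.mpr c.ne_zero
    rw [Complex.normSq_apply] at h
    rw [Matrix.mem_glpos]
    change 0 < (Matrix.det !![(c : ℂ).re, -(c : ℂ).im; (c : ℂ).im, (c : ℂ).re] : ℝ)
    rw [Matrix.det_fin_two_of]
    nlinarith⟩

theorem planeLin_scalarGL (c : ℂˣ) (z : ℂ) :
    planeLin (scalarGL c : GL (Fin 2) ℝ) z = (c : ℂ) * z := by
  have h : planeLin (scalarGL c : GL (Fin 2) ℝ) = Matrix.toLin Complex.basisOneI Complex.basisOneI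
      !![(c : ℂ).re, -(c : ℂ).im; (c : ℂ).im, (c : ℂ).re] := rfl
  rw [h, Matrix.toLin_apply]
  apply Complex.ext <;>
    simp [Matrix.mulVec, dotProduct, Fin.sum_univ_two] <;> ring

theorem smul_I_eq_I_iff (g : GL(2, ℝ)⁺) : g • I = I ↔ ∃ c : ℂˣ, g = scalarGL c := by
  have key : g • I = I ↔ (g : GL (Fin 2) ℝ) 0 0 = (g : GL (Fin 2) ℝ) 1 1 ∧
      (g : GL (Fin 2) ℝ) 0 1 = -(g : GL (Fin 2) ℝ) 1 0 := by
    have hd := denom_ne_zero (g : GL (Fin 2) ℝ) I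
    rw [UpperHalfPlane.ext_iff, show ((g • I : ℍ) : ℂ) = _ from coe_smul_of_det_pos g.2 I,
      div_eq_iff hd, Complex.ext_iff]
    simp [num, denom]
    tauto
  rw [key]
  constructor
  · rintro ⟨h1, h2⟩
    have hdet := g.2
    rw [Matrix.mem_glpos, Matrix.GeneralLinearGroup.val_det_apply, Matrix.det_fin_two] at hdet
    have hc : (⟨(g : GL (Fin 2) ℝ) 0 0, (g : GL (Fin 2) ℝ) 1 0⟩ : ℂ) ≠ 0 := by
      intro h0
      have h3 := congrArg Complex.re h0
      have h4 := congrArg Complex.im h0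
      simp only [Complex.zero_re, Complex.zero_im] at h3 h4
      rw [h3, h4] at hdet
      simp at hdet
    refine ⟨Units.mk0 _ hc, ?_⟩
    apply Subtype.ext
    apply Matrix.GeneralLinearGroup.ext
    intro i j
    fin_cases i <;> fin_cases j <;> simp [scalarGL, h1, h2]
  · rintro ⟨c, rfl⟩
    simp [scalarGL]

/-- The uniformization of `Q'_D`. For a pair `p` with stabilizer `Γ` in `GL⁺(2, ℝ)`, sending
`g • p` to `g⁻¹ • i` identifies the quotient by `ℂ^*` of the orbit `GL⁺(2, ℝ) • p` with `Γ \ ℍ`. -/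
theorem orbit_mod_scalars (p : PlaneLattice × PlaneLattice) (g h : GL(2, ℝ)⁺) :
    (∃ c : ℂˣ, scalarGL c • g • p = h • p) ↔
      ∃ γ ∈ MulAction.stabilizer GL(2, ℝ)⁺ p, γ • g⁻¹ • I = h⁻¹ • I := by
  constructor
  · rintro ⟨c, hc⟩
    refine ⟨h⁻¹ * scalarGL c * g, ?_, ?_⟩
    · rw [MulAction.mem_stabilizer_iff, mul_smul, mul_smul, hc, inv_smul_smul]
    · rw [mul_smul, smul_inv_smul, mul_smul, (smul_I_eq_I_iff _).mpr ⟨c, rfl⟩]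
  · rintro ⟨γ, hγ, hI⟩
    obtain ⟨c, hc⟩ := (smul_I_eq_I_iff (h * γ * g⁻¹)).mp (by
      rw [mul_smul, mul_smul, hI, smul_inv_smul])
    refine ⟨c, ?_⟩
    rw [← hc, mul_smul, mul_smul, inv_smul_smul, MulAction.mem_stabilizer_iff.mp hγ]

/-- The group of transformations of `ℍ` induced by a subgroup `Γ` of `GL⁺(2, ℝ)`: the image of `Γ`
in `PGL(2, ℝ)`, which acts faithfully on `ℍ`. -/
def projImage (Γ : Subgroup GL(2, ℝ)⁺) : Subgroup PGL(2, ℝ) :=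
  Γ.map (Matrix.ProjGenLinGroup.mk.comp (Matrix.GLPos (Fin 2) ℝ).subtype)

/-- `Γ \ ℍ` has finite hyperbolic area. -/
def HasFiniteArea (Γ : Subgroup GL(2, ℝ)⁺) : Prop :=
  HasFundamentalDomain (projImage Γ) ℍ ∧ covolume (projImage Γ) ℍ ≠ ⊤

/-- The orbifold Euler characteristic `-(1 / 2π) ∫ dx dy / y²` of the hyperbolic orbifold
`Γ \ ℍ`; the integral is over a fundamental domain. -/
def orbifoldEulerChar (Γ : Subgroup GL(2, ℝ)⁺) : ℝ :=
  -(1 / (2 * Real.pi)) * (covolume (projImage Γ) ℍ).toReal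

/-- The `GL⁺(2, ℝ)`-orbits in `ΩQ'_D`; their quotients by `ℂ^*` are the components of `Q'_D`. -/
def components (D : ℕ) :
    Set (MulAction.orbitRel.Quotient GL(2, ℝ)⁺ (PlaneLattice × PlaneLattice)) :=
  Quotient.mk _ '' OmegaQPrime D

/-- The stabilizer `Γ` of a point in an orbit (well-defined up to conjugation), so that the quotient
by `ℂ^*` of the orbit is `Γ \ ℍ`. -/
def orbitGroup (o : MulAction.orbitRel.Quotient GL(2, ℝ)⁺ (PlaneLattice × PlaneLattice)) :
    Subgroup GL(2, ℝ)⁺ :=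
  MulAction.stabilizer GL(2, ℝ)⁺ (Quotient.out o)

/-- `Q'_D` is a finite union of hyperbolic orbifolds `Γ \ ℍ` of finite area. -/
def QPrimeFinite (D : ℕ) : Prop :=
  (components D).Finite ∧ ∀ o ∈ components D, HasFiniteArea (orbitGroup o)

/-- The orbifold Euler characteristic `χ(Q'_D)`: the sum over the components `Γ \ ℍ` of `Q'_D`. -/
def chiQPrime (D : ℕ) : ℝ :=
  ∑ᶠ o ∈ components D, orbifoldEulerChar (orbitGroup o)

/-! ## `(1, 2)`-primitive discriminants -/

/-- `D ≡ 0, 1, 4` modulo `8`. -/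
def IsOneTwoDiscriminant (D : ℕ) : Prop := D % 8 = 0 ∨ D % 8 = 1 ∨ D % 8 = 4

/-- `D > 9` is a `(1, 2)`-primitive discriminant. -/
def IsOneTwoPrimitive (D : ℕ) : Prop :=
  9 < D ∧ IsOneTwoDiscriminant D ∧
    ¬ ∃ f D' : ℕ, 1 < f ∧ D = f ^ 2 * D' ∧ IsOneTwoDiscriminant D'

end PrymEigenform

end

/-!
The group `GL⁺(2, ℝ)` acts transitively on lattices, and the stabilizer of the square lattice
`ℤ + ℤ i` is `SL(2, ℤ)`. Therefore each orbit of pairs of lattices is determined by its fibre over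
the square lattice, that is, by the set of `M` for which the pair of `M` and the square lattice lies
in the orbit. This fibre is an orbit of `SL(2, ℤ)`, and its size is the index in `SL(2, ℤ)` of the
stabilizer of a point. The modular curve has area `π / 3` (`volume_fd`), so a component of `Q'_D`
has Euler characteristic `-1 / 6` times the size of its fibre
(`hasFiniteArea_and_orbifoldEulerChar`). In this way `χ(Q'_D)` is `-1 / 6` times the number of
lattices `M` that form a point of `ΩQ'_D` with the square lattice (`qPrimeFinite_and_chiQPrime`).

A self-adjoint endomorphism for which `dz₁ + dz₂` is an eigenform has a matrix `(a, β; γ, d)` with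
integers `a`, `d` and real numbers `β`, `γ` (`exists_isOffDiagonal`). Here `γ Λ₁` is a sublattice of
`Λ₂` of index `ℓ = β γ / 2`, the eigenform condition says that `β - γ` is the integer `e = a - d`,
and the discriminant of the characteristic polynomial is `(β + γ)² = e² + 8 ℓ`. The sums `β + γ`
form a subgroup of `ℝ` with integral squares, which is hence cyclic, and a pair of lattices lies in
`ΩQ'_D` exactly when `√D` generates this group (`mem_OmegaQPrime_iff`). If the group contains
`√(f² D₀)`, then by primitivity of `D₀` its generator is `√(r² D₀)` for a unique `r ∣ f`. So the sum
over `r` counts the lattices `M` for which `√(f² D₀)` lies in the group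
(`discrFibre_eq_biUnion_eigenformFibre`, `pairwiseDisjoint_eigenformFibre`).

These `M` are sorted by `e`. Since `β` and `γ` are positive and have sum `√(f² D₀)` and difference
`e`, they are determined by `e`, and then `γ M` is an arbitrary sublattice of index
`ℓ = (f² D₀ - e²) / 8` of the square lattice. There are `σ₁(ℓ)` of those by the Hermite normal form
(`ncard_sublattices`).
-/

noncomputable section

namespace PrymEigenform

/-! ### Lattices and covolumes -/

/-- The square lattice `ℤ + ℤ i`. -/
def squareLattice : PlaneLattice where
  carrier := Submodule.span ℤ (Set.range Complex.basisOneI)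
  discrete := inferInstance
  isLattice := inferInstance

theorem mem_squareLattice {z : ℂ} :
    z ∈ squareLattice.carrier ↔ ∃ m n : ℤ, z = m + n * Complex.I := by
  simp only [squareLattice, Complex.coe_basisOneI, Matrix.range_cons, Matrix.range_empty,
    Set.union_empty, Set.singleton_union, Submodule.mem_span_pair, zsmul_eq_mul, mul_one]
  constructor
  · rintro ⟨m, n, h⟩; exact ⟨m, n, h.symm⟩
  · rintro ⟨m, n, h⟩; exact ⟨m, n, h.symm⟩

theorem exists_basis (L : PlaneLattice) : Nonempty (Module.Basis (Fin 2) ℤ L.carrier) := by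
  have := L.discrete
  have := L.isLattice
  have := ZLattice.module_free ℝ L.carrier
  have := ZLattice.module_finite ℝ L.carrier
  exact ⟨Module.finBasisOfFinrankEq ℤ L.carrier
    (by rw [ZLattice.rank ℝ L.carrier, Complex.finrank_real_complex])⟩

theorem volume_fundamentalDomain_basisOneI :
    (volume : Measure ℂ).real (ZSpan.fundamentalDomain Complex.basisOneI) = 1 := by
  rw [measureReal_congr (ZSpan.fundamentalDomain_ae_parallelepiped Complex.basisOneI volume),
    ← Complex.toBasis_orthonormalBasisOneI, OrthonormalBasis.coe_toBasis, measureReal_def,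
    OrthonormalBasis.volume_parallelepiped, ENNReal.toReal_one]

theorem covolume_eq_abs_det (L : PlaneLattice) (b : Module.Basis (Fin 2) ℤ L.carrier) :
    ZLattice.covolume L.carrier = |Complex.basisOneI.det ((↑) ∘ b)| := by
  have := L.discrete
  have := L.isLattice
  rw [ZLattice.covolume_eq_det_mul_measureReal L.carrier volume b Complex.basisOneI,
    volume_fundamentalDomain_basisOneI, mul_one]

theorem covolume_pos (L : PlaneLattice) : 0 < ZLattice.covolume L.carrier := by
  have := L.discrete
  have := L.isLattice
  exact ZLattice.covolume_pos _ _

theorem planeLin_injective (g : GL (Fin 2) ℝ) : Function.Injective (planeLin g) :=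
  (planeEquiv g).injective

/-- `GL(2, ℝ)` scales covolumes by the absolute value of the determinant, since it maps `ℤ`-bases to
`ℤ`-bases. -/
theorem covolume_smul (g : GL (Fin 2) ℝ) (L : PlaneLattice) :
    ZLattice.covolume (g • L).carrier =
      |(g : Matrix (Fin 2) (Fin 2) ℝ).det| * ZLattice.covolume L.carrier := by
  obtain ⟨b⟩ := exists_basis L
  let e : L.carrier ≃ₗ[ℤ] (g • L).carrier :=
    Submodule.equivMapOfInjective ((planeLin g).restrictScalars ℤ) (planeLin_injective g) L.carrier
  have h : ((↑) ∘ (b.map e) : Fin 2 → ℂ) = planeLin g ∘ ((↑) ∘ b) := by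
    ext i
    rfl
  rw [covolume_eq_abs_det _ (b.map e), h, covolume_eq_abs_det L b, Module.Basis.det_comp, abs_mul,
    planeLin, LinearMap.det_toLin]

theorem covolume_squareLattice : ZLattice.covolume squareLattice.carrier = 1 := by
  have := squareLattice.discrete
  have := squareLattice.isLattice
  rw [ZLattice.covolume_eq_measure_fundamentalDomain squareLattice.carrier volume
    (ZSpan.isAddFundamentalDomain Complex.basisOneI volume), volume_fundamentalDomain_basisOneI]

theorem planeLin_apply (g : GL (Fin 2) ℝ) (z : ℂ) :
    planeLin g z = ⟨g 0 0 * z.re + g 0 1 * z.im, g 1 0 * z.re + g 1 1 * z.im⟩ := by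
  rw [planeLin, Matrix.toLin_apply]
  apply Complex.ext <;> simp [Matrix.mulVec, dotProduct, Fin.sum_univ_two]

theorem mem_smul_iff (g : GL (Fin 2) ℝ) (L : PlaneLattice) (z : ℂ) :
    z ∈ (g • L).carrier ↔ ∃ w ∈ L.carrier, planeLin g w = z := Iff.rfl

/-- `GL⁺(2, ℝ)` acts transitively on lattices. -/
theorem exists_smul_squareLattice (L : PlaneLattice) :
    ∃ g : GL(2, ℝ)⁺, g • squareLattice = L := by
  obtain ⟨b⟩ := exists_basis L
  have hdet := covolume_eq_abs_det L b
  have hpos := covolume_pos L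
  rw [hdet, abs_pos] at hpos
  simp [Module.Basis.det_apply, Matrix.det_fin_two, Module.Basis.toMatrix_apply] at hpos
  have hmem : ∀ z, z ∈ L.carrier ↔ ∃ m n : ℤ, (m : ℂ) * (b 0 : ℂ) + n * (b 1 : ℂ) = z := by
    intro z
    constructor
    · intro hz
      refine ⟨b.repr ⟨z, hz⟩ 0, b.repr ⟨z, hz⟩ 1, ?_⟩
      have h := b.sum_repr ⟨z, hz⟩
      rw [Fin.sum_univ_two, Subtype.ext_iff] at h
      simpa only [Submodule.coe_add, Submodule.coe_smul, zsmul_eq_mul] using h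
    · rintro ⟨m, n, rfl⟩
      simpa using L.carrier.add_mem (L.carrier.smul_mem m (b 0).2) (L.carrier.smul_mem n (b 1).2)
  set u : ℂ := ((b 0 : L.carrier) : ℂ)
  set v : ℂ := ((b 1 : L.carrier) : ℂ)
  -- Exchanging the two basis vectors if necessary makes the basis positively oriented.
  obtain ⟨u', v', hpos', hmem'⟩ : ∃ u' v' : ℂ, 0 < u'.re * v'.im - v'.re * u'.im ∧
      ∀ z, z ∈ L.carrier ↔ ∃ m n : ℤ, (m : ℂ) * u' + n * v' = z := by
    rcases lt_or_gt_of_ne hpos with h | h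
    · refine ⟨v, u, by linarith, fun z ↦ (hmem z).trans ?_⟩
      constructor
      · rintro ⟨m, n, h⟩; exact ⟨n, m, by rw [← h]; ring⟩
      · rintro ⟨m, n, h⟩; exact ⟨n, m, by rw [← h]; ring⟩
    · exact ⟨u, v, h, hmem⟩
  let A : Matrix (Fin 2) (Fin 2) ℝ := !![u'.re, v'.re; u'.im, v'.im]
  have hA : 0 < A.det := by simpa [A, Matrix.det_fin_two] using hpos'
  refine ⟨⟨Matrix.GeneralLinearGroup.mkOfDetNeZero A hA.ne', hA⟩, ?_⟩
  ext z
  rw [hmem']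
  change z ∈ (Matrix.GeneralLinearGroup.mkOfDetNeZero A hA.ne' • squareLattice).carrier ↔ _
  have key : ∀ m n : ℤ, planeLin (Matrix.GeneralLinearGroup.mkOfDetNeZero A hA.ne')
      (m + n * Complex.I) = m * u' + n * v' := by
    intro m n
    rw [planeLin_apply]
    apply Complex.ext <;> simp [A, Matrix.GeneralLinearGroup.mkOfDetNeZero] <;> ring
  rw [mem_smul_iff]
  constructor
  · rintro ⟨w, hw, rfl⟩
    obtain ⟨m, n, rfl⟩ := mem_squareLattice.mp hw
    exact ⟨m, n, (key m n).symm⟩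
  · rintro ⟨m, n, rfl⟩
    exact ⟨_, mem_squareLattice.mpr ⟨m, n, rfl⟩, key m n⟩

/-- A sublattice `M` of `L` has a finite index `n`; the index is the quotient of the covolumes, and
`n L ⊆ M`. -/
theorem exists_index (M L : PlaneLattice) (h : M.carrier ≤ L.carrier) :
    ∃ n : ℕ, 0 < n ∧ ZLattice.covolume M.carrier = n * ZLattice.covolume L.carrier ∧
      ∀ z ∈ L.carrier, (n : ℂ) * z ∈ M.carrier := by
  have := L.discrete
  have := L.isLattice
  have := M.discrete
  have := M.isLattice
  have key := ZLattice.covolume_div_covolume_eq_relIndex' M.carrier L.carrier h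
  rw [div_eq_iff (covolume_pos L).ne'] at key
  refine ⟨_, ?_, key, fun z hz ↦ ?_⟩
  · by_contra h0
    rw [Nat.eq_zero_of_not_pos h0, Nat.cast_zero, zero_mul] at key
    exact (covolume_pos M).ne' key
  · simpa using AddSubgroup.nsmul_relIndex_mem (H := M.carrier.toAddSubgroup)
      (K := L.carrier.toAddSubgroup) hz

/-! ### Fundamental domains of subgroups -/

section Hyperbolic

open scoped Pointwise Modular

section FundamentalDomain

variable {G α : Type*} [Group G] [MulAction G α] [MeasurableSpace α] {μ : Measure α}
  [MeasurableConstSMul G α] [SMulInvariantMeasure G α μ]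

/-- A subgroup `H` of finite index in `K` has a fundamental domain that consists of one translate of
a fundamental domain of `K` for each coset of `H`. -/
theorem exists_isFundamentalDomain_of_relIndex_ne_zero {H K : Subgroup G} (hHK : H ≤ K) {s : Set α}
    (hs : IsFundamentalDomain K s μ) (hfin : H.relIndex K ≠ 0) :
    ∃ t : Set α, IsFundamentalDomain H t μ ∧ μ t = H.relIndex K * μ s := by
  have hfi : Finite (K ⧸ H.subgroupOf K) := by
    have : (H.subgroupOf K).FiniteIndex := ⟨hfin⟩
    exact Subgroup.finite_quotient_of_finiteIndex
  -- The inverses of representatives of the left cosets represent the right cosets `H \ K`.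
  let r : K ⧸ H.subgroupOf K → K := fun q ↦ q.out⁻¹
  have hr : ∀ (h : H) q q', (⟨h, hHK h.2⟩ : K) * r q = r q' → q = q' ∧ h = 1 := by
    intro h q q' e
    have e1 : q.out = q'.out * ⟨h, hHK h.2⟩ := by
      have : r q = (⟨h, hHK h.2⟩ : K)⁻¹ * r q' := by rw [← e]; group
      simpa [r] using congrArg (·⁻¹) this
    have e2 : q = q' := by
      rw [← q.out_eq', ← q'.out_eq']
      refine (QuotientGroup.eq.mpr ?_).symm
      rw [Subgroup.mem_subgroupOf, e1]
      simp
    refine ⟨e2, ?_⟩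
    rw [e2] at e1
    have := left_eq_mul.mp e1
    exact Subtype.ext (congrArg (fun k : K ↦ (k : G)) this)
  have hdisj : ∀ k k' : K, k ≠ k' → AEDisjoint μ (k • s) (k' • s) := fun k k' h ↦ hs.aedisjoint h
  refine ⟨⋃ q, r q • s, ⟨?_, ?_, ?_⟩, ?_⟩
  · exact NullMeasurableSet.iUnion fun q ↦ hs.nullMeasurableSet_smul _
  · filter_upwards [hs.ae_covers] with x hx
    obtain ⟨k, hk⟩ := hx
    let q : K ⧸ H.subgroupOf K := (k : K ⧸ H.subgroupOf K)
    have hq : q.out⁻¹ * k ∈ H.subgroupOf K := QuotientGroup.eq.mp q.out_eq'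
    refine ⟨⟨_, hq⟩, Set.mem_iUnion.mpr ⟨q, k • x, hk, ?_⟩⟩
    exact (mul_smul q.out⁻¹ k x).symm
  · intro h h' hne
    simp only [Function.onFun, Set.smul_set_iUnion]
    rw [AEDisjoint.iUnion_left_iff]
    intro q
    rw [AEDisjoint.iUnion_right_iff]
    intro q'
    have e : ∀ (h : H) (q), h • r q • s = ((⟨h, hHK h.2⟩ : K) * r q) • s :=
      fun h q ↦ (mul_smul (⟨h, hHK h.2⟩ : K) (r q) s).symm
    rw [e, e]
    refine hdisj _ _ fun heq ↦ hne ?_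
    have := (hr (h'⁻¹ * h) q q' (by
      have : (⟨((h'⁻¹ * h : H) : G), hHK (h'⁻¹ * h).2⟩ : K) =
        (⟨h', hHK h'.2⟩ : K)⁻¹ * ⟨h, hHK h.2⟩ := rfl
      rw [this, mul_assoc, heq]; group)).2
    exact (inv_mul_eq_one.mp this).symm
  · rw [measure_iUnion₀ _ fun q ↦ hs.nullMeasurableSet_smul _]
    · rw [Subgroup.relIndex, Subgroup.index]
      have : ∀ q, μ (r q • s) = μ s := fun q ↦ measure_smul μ ((r q : K) : G) s
      cases nonempty_fintype (K ⧸ H.subgroupOf K)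
      rw [tsum_fintype, Finset.sum_congr rfl fun q _ ↦ this q]
      simp
    · intro q q' hne
      refine hdisj _ _ fun heq ↦ hne (hr 1 q q' ?_).1
      rw [← heq]
      exact one_mul _

theorem isFundamentalDomain_map_conj {K : Subgroup G} {s : Set α}
    (hs : IsFundamentalDomain K s μ) (g : G) :
    IsFundamentalDomain (K.map (MulAut.conj g).toMonoidHom) (g • s) μ := by
  let e := K.equivMapOfInjective (MulAut.conj g).toMonoidHom (MulAut.conj g).injective
  refine hs.image_of_equiv (MulAction.toPerm g) ?_ e.symm.toEquiv ?_
  · exact (measurePreserving_smul g⁻¹ μ).quasiMeasurePreserving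
  · intro x y
    obtain ⟨k, rfl⟩ := e.surjective x
    simp only [MulEquiv.toEquiv_eq_coe, EquivLike.coe_coe, MulEquiv.symm_apply_apply]
    change g • (k : G) • y = (g * k * g⁻¹) • g • y
    rw [mul_smul, mul_smul, inv_smul_smul]

end FundamentalDomain

/-! ### The modular group and its fundamental domain -/

instance : MeasurableConstSMul PGL(2, ℝ) ℍ where
  measurable_const_smul q := by
    obtain ⟨g, rfl⟩ := Matrix.ProjGenLinGroup.mk_surjective q
    exact (continuous_const_smul g).measurable

instance : SMulInvariantMeasure PGL(2, ℝ) ℍ volume where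
  measure_preimage_smul q s hs := by
    obtain ⟨g, rfl⟩ := Matrix.ProjGenLinGroup.mk_surjective q
    exact (measurePreserving_smul g volume).measure_preimage hs.nullMeasurableSet

/-- The stabilizer of the square lattice in `GL⁺(2, ℝ)` is `SL(2, ℤ)`: an element of the stabilizer
has integer entries, and it has determinant `1` because it preserves the covolume. -/
theorem mem_stabilizer_squareLattice {g : GL(2, ℝ)⁺} :
    g ∈ MulAction.stabilizer GL(2, ℝ)⁺ squareLattice ↔
      ∃ γ : SL(2, ℤ), (g : GL (Fin 2) ℝ) = Matrix.SpecialLinearGroup.mapGL ℝ γ := by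
  rw [MulAction.mem_stabilizer_iff]
  constructor
  · intro hg
    change (g : GL (Fin 2) ℝ) • squareLattice = squareLattice at hg
    have hdet := covolume_smul (g : GL (Fin 2) ℝ) squareLattice
    rw [hg, covolume_squareLattice, mul_one, abs_of_pos g.2] at hdet
    have h1 : planeLin (g : GL (Fin 2) ℝ) 1 ∈ squareLattice.carrier := by
      rw [← hg]
      exact ⟨1, mem_squareLattice.mpr ⟨1, 0, by simp⟩, rfl⟩
    have h2 : planeLin (g : GL (Fin 2) ℝ) Complex.I ∈ squareLattice.carrier := by
      rw [← hg]
      exact ⟨Complex.I, mem_squareLattice.mpr ⟨0, 1, by simp⟩, rfl⟩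
    obtain ⟨a, c, h1⟩ := mem_squareLattice.mp h1
    obtain ⟨b, d, h2⟩ := mem_squareLattice.mp h2
    rw [planeLin_apply, Complex.ext_iff] at h1 h2
    simp at h1 h2
    have hd : a * d - b * c = 1 := by
      rw [Matrix.det_fin_two, h1.1, h1.2, h2.1, h2.2] at hdet
      exact_mod_cast hdet.symm
    refine ⟨⟨!![a, b; c, d], by rw [Matrix.det_fin_two_of, hd]⟩, ?_⟩
    apply Matrix.GeneralLinearGroup.ext
    intro i j
    fin_cases i <;> fin_cases j
    exacts [h1.1, h2.1, h1.2, h2.2]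
  · rintro ⟨γ, hγ⟩
    have key : ∀ γ : SL(2, ℤ), ∀ z ∈ squareLattice.carrier,
        planeLin (Matrix.SpecialLinearGroup.mapGL ℝ γ) z ∈ squareLattice.carrier := by
      intro γ z hz
      obtain ⟨m, n, rfl⟩ := mem_squareLattice.mp hz
      rw [mem_squareLattice]
      refine ⟨γ 0 0 * m + γ 0 1 * n, γ 1 0 * m + γ 1 1 * n, ?_⟩
      rw [planeLin_apply]
      apply Complex.ext <;> simp
    change (g : GL (Fin 2) ℝ) • squareLattice = squareLattice
    rw [hγ]
    ext z
    constructor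
    · rintro ⟨w, hw, rfl⟩
      exact key γ w hw
    · intro hz
      rw [mem_smul_iff]
      refine ⟨planeLin (Matrix.SpecialLinearGroup.mapGL ℝ γ⁻¹) z, key γ⁻¹ z hz, ?_⟩
      rw [← LinearMap.comp_apply, ← planeLin_mul, ← map_mul, mul_inv_cancel, map_one, planeLin_one,
        LinearMap.id_apply]

theorem mem_projImage_stabilizer_squareLattice {q : PGL(2, ℝ)} :
    q ∈ projImage (MulAction.stabilizer GL(2, ℝ)⁺ squareLattice) ↔
      ∃ γ : SL(2, ℤ), q = Matrix.ProjGenLinGroup.mk (Matrix.SpecialLinearGroup.mapGL ℝ γ) := by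
  constructor
  · rintro ⟨g, hg, rfl⟩
    obtain ⟨γ, hγ⟩ := mem_stabilizer_squareLattice.mp hg
    exact ⟨γ, congrArg Matrix.ProjGenLinGroup.mk hγ⟩
  · rintro ⟨γ, rfl⟩
    have hdet : Matrix.SpecialLinearGroup.mapGL ℝ γ ∈ Matrix.GLPos (Fin 2) ℝ := by
      rw [Matrix.mem_glpos, Matrix.SpecialLinearGroup.det_mapGL]
      exact one_pos
    exact ⟨⟨_, hdet⟩, mem_stabilizer_squareLattice.mpr ⟨γ, rfl⟩, rfl⟩

instance : Countable SL(2, ℤ) :=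
  have : Countable (Matrix (Fin 2) (Fin 2) ℤ) := inferInstanceAs (Countable (Fin 2 → Fin 2 → ℤ))
  inferInstanceAs (Countable {A : Matrix (Fin 2) (Fin 2) ℤ // A.det = 1})

instance : Countable (projImage (MulAction.stabilizer GL(2, ℝ)⁺ squareLattice)) := by
  have : (projImage (MulAction.stabilizer GL(2, ℝ)⁺ squareLattice) : Set PGL(2, ℝ)) ⊆
      Set.range fun γ : SL(2, ℤ) ↦
        Matrix.ProjGenLinGroup.mk (Matrix.SpecialLinearGroup.mapGL ℝ γ) := by
    intro q hq
    obtain ⟨γ, rfl⟩ := mem_projImage_stabilizer_squareLattice.mp hq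
    exact ⟨γ, rfl⟩
  exact ((Set.countable_range _).mono this).to_subtype

/-- The boundary of the standard fundamental domain lies on a circle and two lines, so it is
null. -/
theorem volume_fd_diff_fdo : volume (𝒟 \ 𝒟ᵒ : Set ℍ) = 0 := by
  have hline : ∀ c : ℝ, volume (Complex.re ⁻¹' {c}) = 0 := by
    intro c
    have h := Complex.volume_preserving_equiv_real_prod.measure_preimage
      (s := {c} ×ˢ (Set.univ : Set ℝ))
      ((measurableSet_singleton c).prod MeasurableSet.univ).nullMeasurableSet
    rw [Measure.volume_eq_prod, Measure.prod_prod, Real.volume_singleton, zero_mul] at h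
    rw [← h]
    congr 1
    ext z
    simp
  rw [volume_eq_lintegral]
  refine setLIntegral_measure_zero _ _ (measure_mono_null (t := Metric.sphere 0 1 ∪
    (Complex.re ⁻¹' {1 / 2} ∪ Complex.re ⁻¹' {-(1 / 2)})) ?_ ?_)
  · rintro _ ⟨z, ⟨⟨h1, h2⟩, hz'⟩, rfl⟩
    rcases h1.lt_or_eq with h1 | h1
    · rcases h2.lt_or_eq with h2 | h2
      · exact absurd ⟨h1, h2⟩ hz'
      · exact Or.inr ((abs_eq (by norm_num)).mp h2)
    · left
      rw [Complex.normSq_eq_norm_sq] at h1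
      rw [mem_sphere_zero_iff_norm]
      exact (pow_eq_one_iff_of_nonneg (norm_nonneg _) two_ne_zero).mp h1.symm
  · rw [measure_union_null_iff, measure_union_null_iff]
    exact ⟨Measure.addHaar_sphere _ _ _, hline _, hline _⟩

theorem isFundamentalDomain_fd :
    IsFundamentalDomain (projImage (MulAction.stabilizer GL(2, ℝ)⁺ squareLattice)) (𝒟 : Set ℍ) := by
  refine IsFundamentalDomain.mk'' ModularGroup.isClosed_fd.measurableSet.nullMeasurableSet ?_ ?_ ?_
  · refine Filter.Eventually.of_forall fun z ↦ ?_
    obtain ⟨γ, hγ⟩ := ModularGroup.exists_smul_mem_fd z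
    exact ⟨⟨_, mem_projImage_stabilizer_squareLattice.mpr ⟨γ, rfl⟩⟩, hγ⟩
  · rintro ⟨q, hq⟩ hne
    obtain ⟨γ, rfl⟩ := mem_projImage_stabilizer_squareLattice.mp hq
    set q := Matrix.ProjGenLinGroup.mk (Matrix.SpecialLinearGroup.mapGL ℝ γ) with hq_def
    refine measure_mono_null (t := q • (𝒟 \ 𝒟ᵒ : Set ℍ)) ?_ ?_
    · rintro _ ⟨⟨z, hz, rfl⟩, hz'⟩
      refine ⟨z, ⟨hz, fun hzo ↦ hne ?_⟩, rfl⟩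
      have hz' : γ • z ∈ 𝒟 := hz'
      apply Subtype.ext
      change q = 1
      rcases ModularGroup.eq_one_or_neg_one_of_mem_fdo_mem_fd hzo hz' with h | h
      · rw [hq_def, h, map_one, map_one]
      · rw [hq_def, h, Matrix.ProjGenLinGroup.mk_eq_one,
          Matrix.GeneralLinearGroup.center_eq_range_scalar]
        refine ⟨-1, ?_⟩
        apply Matrix.GeneralLinearGroup.ext
        intro i j
        fin_cases i <;> fin_cases j <;> simp
    · rw [measure_smul, volume_fd_diff_fdo]
  · rintro ⟨q, hq⟩
    exact (measurePreserving_smul q volume).quasiMeasurePreserving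

theorem lintegral_Ici_inv_sq {a : ℝ} (ha : 0 < a) :
    ∫⁻ y in Set.Ici a, ENNReal.ofReal (1 / y ^ 2) = ENNReal.ofReal (1 / a) := by
  rw [setLIntegral_congr Ioi_ae_eq_Ici.symm]
  have e : ∀ y ∈ Set.Ioi a, y ^ (-2 : ℝ) = 1 / y ^ 2 := by
    intro y hy
    rw [Real.rpow_neg (ha.trans hy).le, one_div]
    norm_num
  have hint : IntegrableOn (fun y : ℝ ↦ 1 / y ^ 2) (Set.Ioi a) :=
    (integrableOn_Ioi_rpow_of_lt (by norm_num : (-2 : ℝ) < -1) ha).congr_fun e measurableSet_Ioi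
  rw [← ofReal_integral_eq_lintegral_ofReal hint
    (Filter.Eventually.of_forall fun y ↦ by positivity),
    ← setIntegral_congr_fun measurableSet_Ioi e, integral_Ioi_rpow_of_lt (by norm_num) ha]
  congr 1
  norm_num [Real.rpow_neg_one]

theorem lintegral_inv_sqrt_one_sub_sq :
    ∫⁻ x in Set.Icc (-(1 / 2) : ℝ) (1 / 2), ENNReal.ofReal (1 / √(1 - x ^ 2)) =
      ENNReal.ofReal (Real.pi / 3) := by
  have hpos : ∀ x ∈ Set.Icc (-(1 / 2) : ℝ) (1 / 2), 0 < 1 - x ^ 2 := by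
    intro x hx
    nlinarith [hx.1, hx.2]
  have hcont : ContinuousOn (fun x : ℝ ↦ 1 / √(1 - x ^ 2)) (Set.Icc (-(1 / 2) : ℝ) (1 / 2)) :=
    continuousOn_const.div (by fun_prop) fun x hx ↦ (Real.sqrt_pos.mpr (hpos x hx)).ne'
  have hle : (-(1 / 2) : ℝ) ≤ 1 / 2 := by norm_num
  rw [← ofReal_integral_eq_lintegral_ofReal hcont.integrableOn_Icc
    (Filter.Eventually.of_forall fun x ↦ by positivity), integral_Icc_eq_integral_Ioc,
    ← intervalIntegral.integral_of_le hle]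
  rw [intervalIntegral.integral_eq_sub_of_hasDerivAt (f := Real.arcsin)]
  · congr 1
    have : Real.arcsin (1 / 2) = Real.pi / 6 := by
      rw [← Real.sin_pi_div_six, Real.arcsin_sin] <;> linarith [Real.pi_pos]
    rw [Real.arcsin_neg, this]
    ring
  · intro x hx
    rw [Set.uIcc_of_le hle] at hx
    exact Real.hasDerivAt_arcsin (by linarith [hx.1]) (by linarith [hx.2])
  · exact hcont.intervalIntegrable_of_Icc hle

/-- The modular surface has hyperbolic area `π / 3`. -/
theorem volume_fd : volume (𝒟 : Set ℍ) = ENNReal.ofReal (Real.pi / 3) := by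
  let S : Set (ℝ × ℝ) := {p | p.1 ∈ Set.Icc (-(1 / 2) : ℝ) (1 / 2) ∧ √(1 - p.1 ^ 2) ≤ p.2}
  have hS : MeasurableSet S := by
    refine (measurable_fst measurableSet_Icc).inter (measurableSet_le ?_ measurable_snd)
    fun_prop
  -- Above `x`, the domain is the half-line `y ≥ √(1 - x²)`, of `dy / y²`-measure `1 / √(1 - x²)`.
  have hpos : ∀ x ∈ Set.Icc (-(1 / 2) : ℝ) (1 / 2), 0 < √(1 - x ^ 2) := by
    intro x hx
    exact Real.sqrt_pos.mpr (by nlinarith [hx.1, hx.2])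
  have himage : ((↑) '' 𝒟 : Set ℂ) = Complex.measurableEquivRealProd ⁻¹' S := by
    rw [ModularGroup.coe_fd]
    ext z
    simp only [Set.mem_ofPred_eq, Set.mem_preimage, S, Complex.measurableEquivRealProd_apply,
      Set.mem_Icc, ← abs_le, Real.sqrt_le_iff]
    rw [← sq_le_sq₀ zero_le_one (norm_nonneg z), Complex.sq_norm, Complex.normSq_apply]
    constructor
    · rintro ⟨h1, h2, h3⟩
      exact ⟨h3, h1.le, by nlinarith⟩
    · rintro ⟨h1, h2, h3⟩
      refine ⟨lt_of_le_of_ne h2 fun h0 ↦ ?_, by nlinarith, h1⟩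
      rw [← h0] at h3
      rw [abs_le] at h1
      nlinarith [h1.1, h1.2]
  rw [volume_eq_lintegral, himage]
  have hfun : ∀ z : ℂ, ((((1 / ‖z.im‖₊) ^ 2 : NNReal)) : ENNReal) =
      ENNReal.ofReal (1 / (Complex.measurableEquivRealProd z).2 ^ 2) := by
    intro z
    rw [← ENNReal.ofReal_coe_nnreal]
    congr 1
    simp
  simp_rw [hfun]
  rw [Complex.volume_preserving_equiv_real_prod.setLIntegral_comp_preimage_emb
    Complex.measurableEquivRealProd.measurableEmbedding
    (fun p ↦ ENNReal.ofReal (1 / p.2 ^ 2)) S, ← lintegral_indicator hS, Measure.volume_eq_prod,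
    lintegral_prod _ (Measurable.aemeasurable (Measurable.indicator (by fun_prop) hS)),
    ← lintegral_inv_sqrt_one_sub_sq, ← lintegral_indicator measurableSet_Icc]
  refine lintegral_congr fun x ↦ ?_
  by_cases hx : x ∈ Set.Icc (-(1 / 2) : ℝ) (1 / 2)
  · rw [Set.indicator_of_mem hx, ← lintegral_Ici_inv_sq (hpos x hx),
      ← lintegral_indicator measurableSet_Ici]
    refine lintegral_congr fun y ↦ ?_
    by_cases hy : √(1 - x ^ 2) ≤ y
    · rw [Set.indicator_of_mem (show (x, y) ∈ S from ⟨hx, hy⟩),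
        Set.indicator_of_mem (Set.mem_Ici.mpr hy)]
    · rw [Set.indicator_of_notMem (fun h : (x, y) ∈ S ↦ hy h.2),
        Set.indicator_of_notMem (fun h ↦ hy (Set.mem_Ici.mp h))]
  · rw [Set.indicator_of_notMem hx]
    refine (lintegral_congr fun y ↦ ?_).trans lintegral_zero
    exact Set.indicator_of_notMem (fun h : (x, y) ∈ S ↦ hx h.1) _

/-! ### The Euler characteristic of a component -/

theorem map_conj_projImage (Γ : Subgroup GL(2, ℝ)⁺) (g : GL(2, ℝ)⁺) :
    projImage (Γ.map (MulAut.conj g).toMonoidHom) = (projImage Γ).map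
      (MulAut.conj (Matrix.ProjGenLinGroup.mk (g : GL (Fin 2) ℝ))).toMonoidHom := by
  rw [projImage, projImage, Subgroup.map_map, Subgroup.map_map]
  congr 1

/-- A scalar that preserves one lattice is `±1`, because it preserves the covolume. Hence it
preserves every lattice. -/
theorem scalar_smul_eq_of_smul_eq {u : ℝˣ} {L : PlaneLattice}
    (h : Matrix.GeneralLinearGroup.scalar (Fin 2) u • L = L) (M : PlaneLattice) :
    Matrix.GeneralLinearGroup.scalar (Fin 2) u • M = M := by
  have hlin : ∀ z, planeLin (Matrix.GeneralLinearGroup.scalar (Fin 2) u) z = (u : ℝ) * z := by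
    intro z
    rw [planeLin_apply]
    apply Complex.ext <;> simp
  have hu : (u : ℝ) ^ 2 = 1 := by
    have hdet := covolume_smul (Matrix.GeneralLinearGroup.scalar (Fin 2) u) L
    rw [h] at hdet
    have := mul_right_cancel₀ (covolume_pos L).ne' (hdet.symm.trans (one_mul _).symm)
    simpa [Matrix.det_fin_two, ← sq] using this
  ext z
  rw [mem_smul_iff]
  rcases sq_eq_sq_iff_eq_or_eq_neg.mp (hu.trans (one_pow 2).symm) with h1 | h1
  · simp [hlin, h1]
  · simp only [hlin, h1]
    constructor
    · rintro ⟨w, hw, rfl⟩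
      simpa using hw
    · intro hz
      exact ⟨-z, M.carrier.neg_mem hz, by simp⟩

/-- Scalars that preserve one of the lattices preserve both, so passing to projective images does
not change the index of the stabilizer of `p` in the stabilizer of its second lattice. -/
theorem relIndex_projImage (p : PlaneLattice × PlaneLattice) :
    (projImage (MulAction.stabilizer GL(2, ℝ)⁺ p)).relIndex
        (projImage (MulAction.stabilizer GL(2, ℝ)⁺ p.2)) =
      (MulAction.stabilizer GL(2, ℝ)⁺ p).relIndex (MulAction.stabilizer GL(2, ℝ)⁺ p.2) := by
  rw [projImage, projImage, ← Subgroup.relIndex_comap, ← Subgroup.inf_relIndex_right]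
  congr 1
  ext g
  rw [Subgroup.mem_inf, Subgroup.mem_comap]
  constructor
  · rintro ⟨⟨s, hs, hsg⟩, hg⟩
    obtain ⟨u, hu⟩ := Matrix.ProjGenLinGroup.mk_eq_mk_iff.mp hsg
    have hs : (s : GL (Fin 2) ℝ) • p = p := hs
    have hg : (g : GL (Fin 2) ℝ) • p.2 = p.2 := hg
    have hu : (s : GL (Fin 2) ℝ) * Matrix.GeneralLinearGroup.scalar (Fin 2) u = g := hu
    have hs1 : (s : GL (Fin 2) ℝ) • p.1 = p.1 := congrArg Prod.fst hs
    have hs2 : (s : GL (Fin 2) ℝ) • p.2 = p.2 := congrArg Prod.snd hs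
    have hfix : Matrix.GeneralLinearGroup.scalar (Fin 2) u • p.2 = p.2 := by
      rwa [← hu, mul_smul, ← eq_inv_smul_iff, ← eq_inv_smul_iff.mpr hs2] at hg
    change (g : GL (Fin 2) ℝ) • p = p
    refine Prod.ext ?_ hg
    rw [Prod.smul_fst, ← hu, mul_smul, scalar_smul_eq_of_smul_eq hfix, hs1]
  · intro hg
    exact ⟨⟨g, hg, rfl⟩, congrArg Prod.snd hg⟩

/-- The fibre over the square lattice of the orbit `o`: the lattices `M` such that the pair of `M`
and the square lattice lies in `o`. -/
def orbitFibre (o : MulAction.orbitRel.Quotient GL(2, ℝ)⁺ (PlaneLattice × PlaneLattice)) :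
    Set PlaneLattice :=
  {M | Quotient.mk _ (M, squareLattice) = o}

theorem exists_mem_orbitFibre
    (o : MulAction.orbitRel.Quotient GL(2, ℝ)⁺ (PlaneLattice × PlaneLattice)) :
    ∃ M, M ∈ orbitFibre o := by
  induction o using Quotient.inductionOn with | h p =>
  obtain ⟨g, hg⟩ := exists_smul_squareLattice p.2
  refine ⟨g⁻¹ • p.1, Quotient.sound ⟨g⁻¹, ?_⟩⟩
  exact Prod.ext rfl (by simp [← hg])

/-- The fibre of an orbit over the square lattice is an orbit of `SL(2, ℤ)`. -/
theorem relIndex_stabilizer_eq_ncard_orbitFibre (L : PlaneLattice) :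
    (MulAction.stabilizer GL(2, ℝ)⁺ (L, squareLattice)).relIndex
        (MulAction.stabilizer GL(2, ℝ)⁺ squareLattice) =
      (orbitFibre (Quotient.mk _ (L, squareLattice))).ncard := by
  have h1 : (MulAction.stabilizer GL(2, ℝ)⁺ (L, squareLattice)).subgroupOf
      (MulAction.stabilizer GL(2, ℝ)⁺ squareLattice) =
      MulAction.stabilizer (MulAction.stabilizer GL(2, ℝ)⁺ squareLattice) L := by
    ext ⟨g, hg⟩
    rw [MulAction.mem_stabilizer_iff] at hg
    simp [Subgroup.mem_subgroupOf, MulAction.mem_stabilizer_iff, Prod.ext_iff, hg,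
      Subgroup.smul_def]
  have h2 : orbitFibre (Quotient.mk _ (L, squareLattice)) =
      MulAction.orbit (MulAction.stabilizer GL(2, ℝ)⁺ squareLattice) L := by
    ext M
    constructor
    · intro h
      obtain ⟨g, hg⟩ := Quotient.exact h
      exact ⟨⟨g, congrArg Prod.snd hg⟩, congrArg Prod.fst hg⟩
    · rintro ⟨⟨g, hg⟩, rfl⟩
      exact Quotient.sound ⟨g, Prod.ext rfl hg⟩
  rw [Subgroup.relIndex, h1, MulAction.index_stabilizer, h2]

/-- The curve of the orbit `o` is a covering of the modular curve, of orbifold Euler characteristic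
`-1 / 6`, and the fibre of `o` over the square lattice counts its sheets. -/
theorem hasFiniteArea_and_orbifoldEulerChar
    (o : MulAction.orbitRel.Quotient GL(2, ℝ)⁺ (PlaneLattice × PlaneLattice))
    (hfin : (orbitFibre o).Finite) :
    HasFiniteArea (orbitGroup o) ∧
      orbifoldEulerChar (orbitGroup o) = -(1 / 6) * (orbitFibre o).ncard := by
  obtain ⟨L, rfl⟩ := exists_mem_orbitFibre o
  have hne : (orbitFibre (Quotient.mk _ (L, squareLattice))).ncard ≠ 0 :=
    Set.ncard_ne_zero_of_mem (a := L) rfl hfin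
  obtain ⟨g, hg⟩ : ∃ g : GL(2, ℝ)⁺, g • (L, squareLattice) = Quotient.out
      (Quotient.mk (MulAction.orbitRel GL(2, ℝ)⁺ _) (L, squareLattice)) :=
    Quotient.exact (Quotient.out_eq (s := MulAction.orbitRel GL(2, ℝ)⁺ _) _)
  have hle : projImage (MulAction.stabilizer GL(2, ℝ)⁺ (L, squareLattice)) ≤
      projImage (MulAction.stabilizer GL(2, ℝ)⁺ squareLattice) :=
    Subgroup.map_mono fun γ hγ ↦ congrArg Prod.snd hγ
  have hidx := relIndex_projImage (L, squareLattice)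
  rw [relIndex_stabilizer_eq_ncard_orbitFibre] at hidx
  obtain ⟨t, ht, hvol⟩ := exists_isFundamentalDomain_of_relIndex_ne_zero hle isFundamentalDomain_fd
    (by rw [hidx]; exact hne)
  have ht' := isFundamentalDomain_map_conj ht (Matrix.ProjGenLinGroup.mk (g : GL (Fin 2) ℝ))
  rw [hidx, volume_fd, ← measure_smul volume (Matrix.ProjGenLinGroup.mk (g : GL (Fin 2) ℝ)) t]
    at hvol
  have hgroup : projImage (orbitGroup (Quotient.mk _ (L, squareLattice))) =
      (projImage (MulAction.stabilizer GL(2, ℝ)⁺ (L, squareLattice))).map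
        (MulAut.conj (Matrix.ProjGenLinGroup.mk (g : GL (Fin 2) ℝ))).toMonoidHom := by
    rw [orbitGroup, ← hg, MulAction.stabilizer_smul_eq_stabilizer_map_conj, map_conj_projImage]
  rw [← hgroup] at ht'
  have hcount : Countable (projImage (orbitGroup (Quotient.mk _ (L, squareLattice)))) := by
    rw [hgroup]
    have : Countable (projImage (MulAction.stabilizer GL(2, ℝ)⁺ (L, squareLattice))) :=
      (Subgroup.inclusion_injective hle).countable
    exact Subgroup.equivMapOfInjective _ _ (MulAut.conj _).injective |>.symm.injective.countable
  have hcov := ht'.covolume_eq_volume volume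
  rw [HasFiniteArea, orbifoldEulerChar, hcov, hvol]
  refine ⟨⟨ht'.hasFundamentalDomain volume, by finiteness⟩, ?_⟩
  rw [ENNReal.toReal_mul, ENNReal.toReal_natCast, ENNReal.toReal_ofReal (by positivity)]
  field_simp
  norm_num

end Hyperbolic

/-! ### Self-adjoint endomorphisms with a given eigenform -/

theorem exists_mem_ne_zero (L : PlaneLattice) : ∃ z ∈ L.carrier, z ≠ 0 := by
  by_contra! h
  have h1 := L.discrete
  have := L.isLattice.span_top
  have hb : (L.carrier : Set ℂ) ⊆ {0} := h
  have h2 := Submodule.span_mono (R := ℝ) hb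
  rw [this, Submodule.span_zero_singleton] at h2
  exact one_ne_zero (h2 (Submodule.mem_top (x := (1 : ℂ))))

theorem eq_zero_of_forall_im_mul_eq_zero {L : PlaneLattice} {c : ℂ}
    (h : ∀ z ∈ L.carrier, (c * z).im = 0) : c = 0 := by
  have h1 := L.discrete
  let f : ℂ →ₗ[ℝ] ℝ := Complex.imLm ∘ₗ LinearMap.mulLeft ℝ c
  have hf : f = 0 := LinearMap.ext_on L.isLattice.span_top fun z hz ↦ h z hz
  have e1 : (c * 1).im = 0 := DFunLike.congr_fun hf 1
  have e2 : (c * Complex.I).im = 0 := DFunLike.congr_fun hf Complex.I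
  apply Complex.ext
  · simpa using e2
  · simpa using e1

theorem exists_int_of_forall_mul_mem {L : PlaneLattice} {a : ℝ}
    (h : ∀ z ∈ L.carrier, (a : ℂ) * z ∈ L.carrier) : ∃ n : ℤ, a = n := by
  obtain ⟨g, rfl⟩ := exists_smul_squareLattice L
  obtain ⟨w, hw, e⟩ := h (planeLin (g : GL (Fin 2) ℝ) 1)
    ⟨1, mem_squareLattice.mpr ⟨1, 0, by simp⟩, rfl⟩
  obtain ⟨m, n, rfl⟩ := mem_squareLattice.mp hw
  have e : planeLin (g : GL (Fin 2) ℝ) (m + n * Complex.I) =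
      planeLin (g : GL (Fin 2) ℝ) (a • (1 : ℂ)) := by
    rw [LinearMap.map_smul, Complex.real_smul]
    exact e
  have := congrArg Complex.re (planeLin_injective _ e)
  exact ⟨m, by simpa using this.symm⟩

/-- The numbers `β` and `γ` are the off-diagonal entries of a self-adjoint endomorphism
`(a, β; γ, d)` of `ℂ / Λ₁ × ℂ / Λ₂` with integers `a`, `d` for which `dz₁ + dz₂` is an eigenform.
The eigenform condition is `β + d = a + γ`, and it can be solved in integers `a`, `d` when `β - γ`
is an integer. -/
structure IsOffDiagonal (p : PlaneLattice × PlaneLattice) (β γ : ℝ) : Prop where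
  mul_mem_fst : ∀ z ∈ p.2.carrier, (β : ℂ) * z ∈ p.1.carrier
  mul_mem_snd : ∀ z ∈ p.1.carrier, (γ : ℂ) * z ∈ p.2.carrier
  sub_int : ∃ e : ℤ, β - γ = e
  adjoint : β * ZLattice.covolume p.2.carrier = 2 * γ * ZLattice.covolume p.1.carrier

namespace IsOffDiagonal

variable {p : PlaneLattice × PlaneLattice} {β γ β' γ' : ℝ}

theorem zero (p : PlaneLattice × PlaneLattice) : IsOffDiagonal p 0 0 :=
  ⟨by simp, by simp, ⟨0, by simp⟩, by simp⟩

theorem add (h : IsOffDiagonal p β γ) (h' : IsOffDiagonal p β' γ') :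
    IsOffDiagonal p (β + β') (γ + γ') := by
  obtain ⟨h1, h2, ⟨e, he⟩, h3⟩ := h
  obtain ⟨h1', h2', ⟨e', he'⟩, h3'⟩ := h'
  refine ⟨fun z hz ↦ ?_, fun z hz ↦ ?_, ⟨e + e', by push_cast; linarith⟩, by linarith⟩
  · rw [Complex.ofReal_add, add_mul]
    exact p.1.carrier.add_mem (h1 z hz) (h1' z hz)
  · rw [Complex.ofReal_add, add_mul]
    exact p.2.carrier.add_mem (h2 z hz) (h2' z hz)

theorem neg (h : IsOffDiagonal p β γ) : IsOffDiagonal p (-β) (-γ) := by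
  obtain ⟨h1, h2, ⟨e, he⟩, h3⟩ := h
  refine ⟨fun z hz ↦ ?_, fun z hz ↦ ?_, ⟨-e, by push_cast; linarith⟩, by linarith⟩
  · simpa using p.1.carrier.neg_mem (h1 z hz)
  · simpa using p.2.carrier.neg_mem (h2 z hz)

/-- If `γ` is nonzero, then the product `β γ` is twice the index of `γ Λ₁` in `Λ₂`. -/
theorem exists_mul_eq (h : IsOffDiagonal p β γ) : ∃ n : ℕ, β * γ = 2 * n := by
  rcases eq_or_ne γ 0 with rfl | hγ
  · exact ⟨0, by simp⟩
  · let c : ℂˣ := Units.mk0 (γ : ℂ) (Complex.ofReal_ne_zero.mpr hγ)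
    have hle : ((scalarGL c : GL (Fin 2) ℝ) • p.1).carrier ≤ p.2.carrier := by
      rintro _ ⟨z, hz, rfl⟩
      change planeLin (scalarGL c : GL (Fin 2) ℝ) z ∈ _
      rw [planeLin_scalarGL]
      exact h.mul_mem_snd z hz
    obtain ⟨n, -, hn, -⟩ := exists_index _ _ hle
    have hdet : (((scalarGL c : GL (Fin 2) ℝ) : Matrix (Fin 2) (Fin 2) ℝ)).det = γ ^ 2 := by
      change Matrix.det !![(c : ℂ).re, -(c : ℂ).im; (c : ℂ).im, (c : ℂ).re] = _
      rw [Matrix.det_fin_two_of]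
      simp [c, sq]
    rw [covolume_smul, hdet, abs_of_nonneg (sq_nonneg γ)] at hn
    refine ⟨n, mul_right_cancel₀ (covolume_pos p.2).ne' ?_⟩
    linear_combination γ * h.adjoint + 2 * hn

theorem exists_sq_eq (h : IsOffDiagonal p β γ) :
    ∃ (e : ℤ) (n : ℕ), β - γ = e ∧ β * γ = 2 * n ∧ (β + γ) ^ 2 = e ^ 2 + 8 * n := by
  obtain ⟨e, he⟩ := h.sub_int
  obtain ⟨n, hn⟩ := h.exists_mul_eq
  exact ⟨e, n, he, hn, by rw [← he]; linear_combination 4 * hn⟩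

theorem fst_eq (h : IsOffDiagonal p β γ) :
    β = 2 * ZLattice.covolume p.1.carrier /
      (2 * ZLattice.covolume p.1.carrier + ZLattice.covolume p.2.carrier) * (β + γ) := by
  have h1 := covolume_pos p.1
  have h2 := covolume_pos p.2
  field_simp
  linear_combination h.adjoint

theorem snd_eq (h : IsOffDiagonal p β γ) :
    γ = ZLattice.covolume p.2.carrier /
      (2 * ZLattice.covolume p.1.carrier + ZLattice.covolume p.2.carrier) * (β + γ) := by
  have h1 := covolume_pos p.1
  have h2 := covolume_pos p.2
  field_simp
  linear_combination -h.adjoint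

/-- The entries `β` and `γ` are determined by their sum. -/
theorem eq_mul_of_add_eq_mul (h : IsOffDiagonal p β γ) (h' : IsOffDiagonal p β' γ') {x : ℝ}
    (hx : β' + γ' = x * (β + γ)) : β' = x * β ∧ γ' = x * γ := by
  constructor
  · exact h'.fst_eq.trans (by rw [hx]; linear_combination (-x) * h.fst_eq)
  · exact h'.snd_eq.trans (by rw [hx]; linear_combination (-x) * h.snd_eq)

end IsOffDiagonal

/-- The group of all sums `β + γ`, for `β` and `γ` the off-diagonal entries of a self-adjoint
endomorphism `(a, β; γ, d)` for which `dz₁ + dz₂` is an eigenform. The discriminant of the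
characteristic polynomial of such an endomorphism is `(a - d)² + 4 β γ = (β + γ)²`. -/
def sqrtDiscrGroup (p : PlaneLattice × PlaneLattice) : AddSubgroup ℝ where
  carrier := {t | ∃ β γ, IsOffDiagonal p β γ ∧ t = β + γ}
  zero_mem' := ⟨0, 0, .zero p, by simp⟩
  add_mem' := by
    rintro _ _ ⟨β, γ, h, rfl⟩ ⟨β', γ', h', rfl⟩
    exact ⟨_, _, h.add h', by ring⟩
  neg_mem' := by
    rintro _ ⟨β, γ, h, rfl⟩
    exact ⟨_, _, h.neg, by ring⟩

/-- The squares of the elements of the group are integers, so the group is discrete, hence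
cyclic. -/
theorem exists_sqrtDiscrGroup_eq_zmultiples (p : PlaneLattice × PlaneLattice) :
    ∃ t : ℝ, 0 ≤ t ∧ sqrtDiscrGroup p = AddSubgroup.zmultiples t := by
  obtain ⟨b, hb⟩ := AddSubgroup.cyclic_of_isolated_zero (H := sqrtDiscrGroup p) one_pos (by
    rw [Set.disjoint_left]
    rintro _ ⟨β, γ, h, rfl⟩ ⟨h0, h1⟩
    obtain ⟨e, n, -, -, hsq⟩ := h.exists_sq_eq
    have h2 : (0 : ℤ) < e ^ 2 + 8 * n := by
      have : (0 : ℝ) < e ^ 2 + 8 * n := by rw [← hsq]; positivity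
      exact_mod_cast this
    have h3 : (e ^ 2 + 8 * n : ℤ) < 1 := by
      have : (e ^ 2 + 8 * n : ℝ) < 1 := by rw [← hsq]; nlinarith
      exact_mod_cast this
    omega)
  rw [← AddSubgroup.zmultiples_eq_closure] at hb
  rcases le_total 0 b with h | h
  · exact ⟨b, h, hb⟩
  · exact ⟨-b, by linarith, by rw [hb, AddSubgroup.zmultiples_neg]⟩

/-- The endomorphism of `ℂ × ℂ` with matrix `(a, β; γ, d)`. -/
def matrixEnd (a β γ d : ℂ) : Module.End ℂ (ℂ × ℂ) :=
  (a • LinearMap.fst ℂ ℂ ℂ + β • LinearMap.snd ℂ ℂ ℂ).prod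
    (γ • LinearMap.fst ℂ ℂ ℂ + d • LinearMap.snd ℂ ℂ ℂ)

@[simp]
theorem matrixEnd_apply (a β γ d : ℂ) (v : ℂ × ℂ) :
    matrixEnd a β γ d v = (a * v.1 + β * v.2, γ * v.1 + d * v.2) := rfl

theorem eq_matrixEnd (T : Module.End ℂ (ℂ × ℂ)) :
    T = matrixEnd (T (1, 0)).1 (T (0, 1)).1 (T (1, 0)).2 (T (0, 1)).2 := by
  apply LinearMap.prod_ext <;> ext <;> simp

theorem matrixEnd_injective {a β γ d a' β' γ' d' : ℂ}
    (h : matrixEnd a β γ d = matrixEnd a' β' γ' d') : a = a' ∧ β = β' ∧ γ = γ' ∧ d = d' := by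
  have h1 := DFunLike.congr_fun h (1, 0)
  have h2 := DFunLike.congr_fun h (0, 1)
  simp only [matrixEnd_apply, mul_one, mul_zero, add_zero, zero_add, Prod.mk.injEq] at h1 h2
  exact ⟨h1.1, h2.1, h1.2, h2.2⟩

/-- `T` is self-adjoint for the polarization on the period lattice. -/
def IsSelfAdjointEnd (p : PlaneLattice × PlaneLattice) (T : Module.End ℂ (ℂ × ℂ)) : Prop :=
  ∀ v ∈ periodLattice p, ∀ w ∈ periodLattice p, polarization p (T v) w = polarization p v (T w)

/-- A self-adjoint endomorphism for which `dz₁ + dz₂` is an eigenform has integers on the diagonal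
and real numbers off the diagonal. Indeed `conj β = 2 c γ` for a positive number `c` by
self-adjointness, while `β - γ` is an integer by the eigenform condition, so the imaginary parts of
`β` and `γ` are equal and have opposite signs. -/
theorem exists_isOffDiagonal {p : PlaneLattice × PlaneLattice} {T : Module.End ℂ (ℂ × ℂ)}
    (hT : T ∈ endRing p) (hsa : IsSelfAdjointEnd p T) (heig : ∃ c : ℂ, oneForm ∘ₗ T = c • oneForm) :
    ∃ (a d : ℤ) (β γ : ℝ), T = matrixEnd a β γ d ∧ IsOffDiagonal p β γ ∧ β - γ = a - d := by
  obtain ⟨a, β, γ, d, rfl⟩ : ∃ a β γ d, T = matrixEnd a β γ d := ⟨_, _, _, _, eq_matrixEnd T⟩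
  have hc1 := covolume_pos p.1
  have hc2 := covolume_pos p.2
  have hmem1 : ∀ z ∈ p.1.carrier, a * z ∈ p.1.carrier ∧ γ * z ∈ p.2.carrier := by
    intro z hz
    simpa [periodLattice] using hT (z, 0) ⟨hz, p.2.carrier.zero_mem⟩
  have hmem2 : ∀ z ∈ p.2.carrier, β * z ∈ p.1.carrier ∧ d * z ∈ p.2.carrier := by
    intro z hz
    simpa [periodLattice] using hT (0, z) ⟨p.1.carrier.zero_mem, hz⟩
  -- Self-adjointness on each factor forces the diagonal entries to be real.
  have hreal : ∀ (L : PlaneLattice) (c : ℂ), (∀ z ∈ L.carrier,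
      (conj (c * z) * z).im = (conj z * (c * z)).im) → c.im = 0 := by
    intro L c h
    obtain ⟨z, hz, hz0⟩ := exists_mem_ne_zero L
    have h1 := h z hz
    have h2 := Complex.normSq_pos.mpr hz0
    rw [Complex.normSq_apply] at h2
    simp at h1
    have : c.im * (z.re * z.re + z.im * z.im) = 0 := by linarith
    exact (mul_eq_zero.mp this).resolve_right h2.ne'
  have ha : a.im = 0 := hreal p.1 a fun z hz ↦ by
    have := hsa (z, 0) ⟨hz, p.2.carrier.zero_mem⟩ (z, 0) ⟨hz, p.2.carrier.zero_mem⟩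
    simp only [polarization, intersectionForm, matrixEnd_apply, mul_zero, add_zero, map_zero,
      Complex.zero_im, zero_div, zero_mul] at this
    exact (div_left_inj' hc1.ne').mp this
  have hd : d.im = 0 := hreal p.2 d fun z hz ↦ by
    have := hsa (0, z) ⟨p.1.carrier.zero_mem, hz⟩ (0, z) ⟨p.1.carrier.zero_mem, hz⟩
    simp only [polarization, intersectionForm, matrixEnd_apply, mul_zero, zero_add, map_zero,
      Complex.zero_im, zero_div, zero_mul] at this
    exact (div_left_inj' hc2.ne').mp (mul_left_cancel₀ two_ne_zero this)
  -- Self-adjointness between the two factors relates the off-diagonal entries.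
  have hadj : conj β * (ZLattice.covolume p.2.carrier : ℂ) =
      2 * γ * (ZLattice.covolume p.1.carrier : ℂ) := by
    obtain ⟨y, hy, hy0⟩ := exists_mem_ne_zero p.2
    have : (conj β * (ZLattice.covolume p.2.carrier : ℂ) -
        2 * γ * (ZLattice.covolume p.1.carrier : ℂ)) * conj y = 0 := by
      refine eq_zero_of_forall_im_mul_eq_zero (L := p.1) fun z hz ↦ ?_
      have := hsa (0, y) ⟨p.1.carrier.zero_mem, hy⟩ (z, 0) ⟨hz, p.2.carrier.zero_mem⟩
      simp only [polarization, intersectionForm, matrixEnd_apply, mul_zero, zero_add, map_zero,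
        Complex.zero_im, zero_div, zero_mul, add_zero] at this
      rw [div_eq_iff hc1.ne'] at this
      field_simp at this
      simp at this ⊢
      linear_combination this
    exact sub_eq_zero.mp ((mul_eq_zero.mp this).resolve_right (by simpa using hy0))
  obtain ⟨c, hc⟩ := heig
  have e1 : a + γ = c := by simpa [oneForm] using DFunLike.congr_fun hc (1, 0)
  have e2 : β + d = c := by simpa [oneForm] using DFunLike.congr_fun hc (0, 1)
  have himeq : β.im = γ.im := by
    have := congrArg Complex.im (e1.trans e2.symm)
    simp [ha, hd] at this
    exact this.symm
  have hadj_im := congrArg Complex.im hadj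
  have hadj_re := congrArg Complex.re hadj
  simp at hadj_im hadj_re
  have hγ : γ.im = 0 := by
    have : γ.im * (2 * ZLattice.covolume p.1.carrier + ZLattice.covolume p.2.carrier) = 0 := by
      rw [himeq] at hadj_im
      linarith
    exact (mul_eq_zero.mp this).resolve_right (by positivity)
  have hβ : β.im = 0 := himeq.trans hγ
  have ha' : a = (a.re : ℂ) := Complex.ext rfl (by simp [ha])
  have hd' : d = (d.re : ℂ) := Complex.ext rfl (by simp [hd])
  have hβ' : β = (β.re : ℂ) := Complex.ext rfl (by simp [hβ])
  have hγ' : γ = (γ.re : ℂ) := Complex.ext rfl (by simp [hγ])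
  obtain ⟨m, hm⟩ := exists_int_of_forall_mul_mem (L := p.1) (a := a.re) fun z hz ↦ by
    rw [← ha']; exact (hmem1 z hz).1
  obtain ⟨n, hn⟩ := exists_int_of_forall_mul_mem (L := p.2) (a := d.re) fun z hz ↦ by
    rw [← hd']; exact (hmem2 z hz).2
  have hsub : β.re - γ.re = m - n := by
    have := congrArg Complex.re (e1.trans e2.symm)
    simp only [Complex.add_re] at this
    linarith
  refine ⟨m, n, β.re, γ.re, ?_, ⟨fun z hz ↦ ?_, fun z hz ↦ ?_, ⟨m - n, by push_cast; exact hsub⟩,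
    hadj_re⟩, hsub⟩
  · rw [hm] at ha'
    rw [hn] at hd'
    rw [← hβ', ← hγ', ha', hd']
    simp
  · rw [← hβ']; exact (hmem2 z hz).1
  · rw [← hγ']; exact (hmem1 z hz).2

theorem IsOffDiagonal.matrixEnd_mem_endRing {p : PlaneLattice × PlaneLattice} {β γ : ℝ}
    (h : IsOffDiagonal p β γ) (a d : ℤ) : matrixEnd a β γ d ∈ endRing p := by
  rintro v ⟨h1, h2⟩
  refine ⟨p.1.carrier.add_mem ?_ (h.mul_mem_fst _ h2), p.2.carrier.add_mem (h.mul_mem_snd _ h1) ?_⟩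
  · simpa using p.1.carrier.smul_mem a h1
  · simpa using p.2.carrier.smul_mem d h2

theorem IsOffDiagonal.isSelfAdjointEnd {p : PlaneLattice × PlaneLattice} {β γ : ℝ}
    (h : IsOffDiagonal p β γ) (a d : ℤ) : IsSelfAdjointEnd p (matrixEnd a β γ d) := by
  intro v _ w _
  have hc1 := covolume_pos p.1
  have hc2 := covolume_pos p.2
  have hadj := h.adjoint
  simp only [polarization, intersectionForm, matrixEnd_apply]
  field_simp
  simp
  linear_combination
    ((v.2.re * w.1.im - v.2.im * w.1.re) - (v.1.re * w.2.im - v.1.im * w.2.re)) * hadj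

theorem oneForm_comp_matrixEnd {β γ : ℝ} {a d : ℤ}
    (hsub : β - γ = a - d) : oneForm ∘ₗ matrixEnd a β γ d = ((a + γ : ℝ) : ℂ) • oneForm := by
  have : (β : ℂ) + d = a + γ := by
    have : β + d = a + γ := by linarith
    exact_mod_cast this
  apply LinearMap.prod_ext <;> ext <;> simp [oneForm, this]

/-! ### Real multiplication -/

section RealMultiplication

open QuadraticAlgebra

theorem coe_ringHom_apply {D : ℕ} {p : PlaneLattice × PlaneLattice}
    (ρ : QuadOrder D →+* endRing p) (z : QuadOrder D) :
    (ρ z : Module.End ℂ (ℂ × ℂ)) = z.re • 1 + z.im • (ρ omega : Module.End ℂ (ℂ × ℂ)) := by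
  have hz : z = (z.re : QuadOrder D) + z.im • omega := by
    ext <;> simp
  conv_lhs => rw [hz]
  rw [map_add, map_zsmul, map_intCast]
  simp

theorem smul_one_add_smul_matrixEnd (x y a d : ℤ) (β γ : ℝ) :
    x • (1 : Module.End ℂ (ℂ × ℂ)) + y • matrixEnd a β γ d =
      matrixEnd (x + y * a : ℤ) (y * β : ℝ) (y * γ : ℝ) (x + y * d : ℤ) := by
  apply LinearMap.prod_ext <;> ext <;> simp

/-- The polynomial `x² - b x - a` that defines the quadratic order `𝒪_D` has discriminant
`b² + 4 a = D`. -/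
theorem four_mul_div_add_mod_sq {D : ℕ} (hD : D % 4 = 0 ∨ D % 4 = 1) :
    (D : ℤ) = 4 * ((D / 4 : ℕ) : ℤ) + ((D % 2 : ℕ) : ℤ) ^ 2 := by
  have h1 : D % 2 = 0 ∧ D = 4 * (D / 4) ∨ D % 2 = 1 ∧ D = 4 * (D / 4) + 1 := by omega
  rcases h1 with ⟨h1, h2⟩ | ⟨h1, h2⟩ <;> rw [h1] <;> push_cast <;> omega

theorem exists_int_mul_eq_int_mul {p : PlaneLattice × PlaneLattice} {t t' : ℝ}
    (ht : t ∈ sqrtDiscrGroup p) (ht0 : t ≠ 0) (ht' : t' ∈ sqrtDiscrGroup p) :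
    ∃ m n : ℤ, n ≠ 0 ∧ n * t' = m * t := by
  obtain ⟨t₀, -, h⟩ := exists_sqrtDiscrGroup_eq_zmultiples p
  rw [h] at ht ht'
  obtain ⟨n, rfl⟩ := ht
  obtain ⟨m, rfl⟩ := ht'
  refine ⟨m, n, ?_, by simp; ring⟩
  rintro rfl
  simp at ht0

/-- The generator of `𝒪_D` acts by a matrix whose characteristic polynomial has discriminant `D`, so
it contributes `±√D`. By properness, every other endomorphism of the same kind lies in the image of
`𝒪_D`, so it contributes a multiple of `√D`. -/
theorem sqrtDiscrGroup_eq_of_mem_OmegaQPrime {D : ℕ} (hD : D % 4 = 0 ∨ D % 4 = 1)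
    {p : PlaneLattice × PlaneLattice} (hp : p ∈ OmegaQPrime D) :
    sqrtDiscrGroup p = AddSubgroup.zmultiples √D := by
  obtain ⟨ρ, hρ, heig⟩ := hp
  obtain ⟨a, d, β, γ, hT, hoff, hsub⟩ := exists_isOffDiagonal (ρ omega).2
    (hρ.selfAdjoint omega) (heig omega)
  have hρz : ∀ z, (ρ z : Module.End ℂ (ℂ × ℂ)) = matrixEnd (z.re + z.im * a : ℤ)
      (z.im * β : ℝ) (z.im * γ : ℝ) (z.re + z.im * d : ℤ) := fun z ↦ by
    rw [coe_ringHom_apply, hT, smul_one_add_smul_matrixEnd]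
  -- The quadratic equation of the generator determines the trace and the determinant.
  have hsq : (ρ omega : Module.End ℂ (ℂ × ℂ)) * (ρ omega : Module.End ℂ (ℂ × ℂ)) =
      matrixEnd ((D / 4 : ℕ) + (D % 2 : ℕ) * a : ℤ) (((D % 2 : ℕ) : ℤ) * β : ℝ)
        (((D % 2 : ℕ) : ℤ) * γ : ℝ) ((D / 4 : ℕ) + (D % 2 : ℕ) * d : ℤ) := by
    rw [← Subring.coe_mul, ← map_mul, hρz, omega_mul_omega_eq_mk]
  rw [hT] at hsq
  have h1 := DFunLike.congr_fun hsq (1, 0)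
  have h2 := DFunLike.congr_fun hsq (0, 1)
  simp only [Module.End.mul_apply, matrixEnd_apply, mul_one, mul_zero, add_zero, zero_add,
    Prod.mk.injEq] at h1 h2
  have e1 : (a : ℝ) * a + β * γ = ((D / 4 : ℕ) + (D % 2 : ℕ) * a : ℤ) := by exact_mod_cast h1.1
  have e2 : (a : ℝ) * β + β * d = ((D % 2 : ℕ) : ℤ) * β := by exact_mod_cast h2.1
  have hβ : β ≠ 0 := by
    intro h0
    have hγ : γ = 0 := by
      have := hoff.adjoint
      rw [h0, zero_mul] at this
      have hc := covolume_pos p.1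
      simpa [hc.ne'] using this.symm
    have had : a = d := by
      have : (a : ℝ) = d := by rw [h0, hγ] at hsub; linarith
      exact_mod_cast this
    have : ρ omega = ρ (a : QuadOrder D) := by
      apply Subtype.ext
      rw [hT, hρz]
      simp [h0, hγ, had]
    have := congrArg QuadraticAlgebra.im (hρ.faithful this)
    simp at this
  have htr : (a : ℝ) + d = (D % 2 : ℕ) := by
    refine mul_right_cancel₀ hβ ?_
    rw [Int.cast_natCast] at e2
    linear_combination e2
  have hdisc : (β + γ) ^ 2 = D := by
    have h4 : (D : ℝ) = 4 * (D / 4 : ℕ) + ((D % 2 : ℕ) : ℝ) ^ 2 := by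
      exact_mod_cast four_mul_div_add_mod_sq hD
    rw [Int.cast_add, Int.cast_mul, Int.cast_natCast, Int.cast_natCast] at e1
    rw [h4, ← htr]
    rw [← htr] at e1
    linear_combination (β - γ + a - d) * hsub + 4 * e1
  have hne : β + γ ≠ 0 := by
    intro h0
    exact hβ (by rw [hoff.fst_eq, h0, mul_zero])
  have hmain : sqrtDiscrGroup p = AddSubgroup.zmultiples (β + γ) := by
    apply le_antisymm
    · rintro _ ⟨β', γ', hoff', rfl⟩
      obtain ⟨m, n, hn, hmn⟩ := exists_int_mul_eq_int_mul ⟨β, γ, hoff, rfl⟩ hne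
        ⟨β', γ', hoff', rfl⟩
      have hn' : (n : ℝ) ≠ 0 := by exact_mod_cast hn
      obtain ⟨hβ', hγ'⟩ := hoff.eq_mul_of_add_eq_mul hoff' (x := m / n) (by
        field_simp
        linarith)
      obtain ⟨e', he'⟩ := hoff'.sub_int
      -- The multiple `n T'` lies in the image of the order, hence `T'` does.
      let T' : endRing p := ⟨matrixEnd e' β' γ' (0 : ℤ), hoff'.matrixEnd_mem_endRing e' 0⟩
      have hmem : n • T' ∈ ρ.range := by
        refine ⟨⟨-m * d, m⟩, Subtype.ext ?_⟩
        rw [hρz]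
        have hzero := smul_one_add_smul_matrixEnd 0 n e' 0 β' γ'
        rw [zero_smul, zero_add] at hzero
        change _ = n • matrixEnd e' β' γ' (0 : ℤ)
        rw [hzero]
        have f1 : m * β = n * β' := by rw [hβ']; field_simp
        have f2 : m * γ = n * γ' := by rw [hγ']; field_simp
        have f3 : -m * d + m * a = 0 + n * e' := by
          have : (-m * d + m * a : ℝ) = 0 + n * e' := by
            rw [← he']
            linear_combination f1 - f2 - m * hsub
          exact_mod_cast this
        simp only [f1, f2, f3]
        congr 2
        ring
      obtain ⟨z, hz⟩ := hρ.proper T' n hn hmem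
      have hz := congrArg (fun S : endRing p ↦ (S : Module.End ℂ (ℂ × ℂ))) hz
      simp only [hρz] at hz
      obtain ⟨-, g1, g2, -⟩ := matrixEnd_injective hz
      have g1 : z.im * β = β' := by exact_mod_cast g1
      have g2 : z.im * γ = γ' := by exact_mod_cast g2
      refine ⟨z.im, ?_⟩
      simp only [zsmul_eq_mul]
      linear_combination g1 + g2
    · rw [AddSubgroup.zmultiples_le]
      exact ⟨β, γ, hoff, rfl⟩
  rw [hmain, ← hdisc, Real.sqrt_sq_eq_abs]
  rcases abs_choice (β + γ) with h | h <;> rw [h]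
  rw [AddSubgroup.zmultiples_neg]

theorem polarization_zsmul_left (p : PlaneLattice × PlaneLattice) (m : ℤ) (v w : ℂ × ℂ) :
    polarization p (m • v) w = m * polarization p v w := by
  simp [polarization, intersectionForm]
  ring

theorem polarization_zsmul_right (p : PlaneLattice × PlaneLattice) (m : ℤ) (v w : ℂ × ℂ) :
    polarization p v (m • w) = m * polarization p v w := by
  simp [polarization, intersectionForm]
  ring

/-- An endomorphism that contributes `√D` can be given the trace `D % 2` by adding an integer. Then
it satisfies the equation of the generator of `𝒪_D`, and it defines a real multiplication, which is
proper because `√D` generates the group. -/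
theorem mem_OmegaQPrime_of_sqrtDiscrGroup_eq {D : ℕ} (hD0 : 0 < D)
    (hD : D % 4 = 0 ∨ D % 4 = 1) {p : PlaneLattice × PlaneLattice}
    (hp : sqrtDiscrGroup p = AddSubgroup.zmultiples √D) : p ∈ OmegaQPrime D := by
  obtain ⟨β, γ, hoff, ht⟩ : √D ∈ sqrtDiscrGroup p := by
    rw [hp]; exact AddSubgroup.mem_zmultiples _
  obtain ⟨e, n, he, hn, hsq⟩ := hoff.exists_sq_eq
  have hDe : (D : ℤ) = e ^ 2 + 8 * n := by
    rw [← ht, Real.sq_sqrt (Nat.cast_nonneg D)] at hsq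
    exact_mod_cast hsq
  have h4 := four_mul_div_add_mod_sq hD
  have hβ : β ≠ 0 := by
    intro h0
    have hγ : γ = 0 := by
      have := hoff.adjoint
      rw [h0, zero_mul] at this
      have hc := covolume_pos p.1
      simpa [hc.ne'] using this.symm
    rw [h0, hγ, add_zero, Real.sqrt_eq_zero (Nat.cast_nonneg D)] at ht
    exact hD0.ne' (by exact_mod_cast ht)
  -- The integers `e` and `D % 2` have the same parity, so there is a generator with trace `D % 2`.
  obtain ⟨d, hd⟩ : ∃ d : ℤ, ((D % 2 : ℕ) : ℤ) = 2 * d + e := by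
    have h1 : ((D % 2 : ℕ) : ℤ) % 2 = e % 2 := by
      have hpar : (D : ℤ) % 2 = e ^ 2 % 2 := by omega
      have : e ^ 2 % 2 = e % 2 := by
        rcases Int.even_or_odd e with he | he
        · obtain ⟨k, rfl⟩ := he
          have : (k + k) ^ 2 = 2 * (2 * k ^ 2) := by ring
          omega
        · obtain ⟨k, rfl⟩ := he
          have : (2 * k + 1) ^ 2 = 2 * (2 * k ^ 2 + 2 * k) + 1 := by ring
          omega
      omega
    exact ⟨(((D % 2 : ℕ) : ℤ) - e) / 2, by omega⟩
  set a : ℤ := d + e with ha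
  have hsub : β - γ = a - d := by rw [he, ha]; push_cast; ring
  let T : endRing p := ⟨matrixEnd a β γ d, hoff.matrixEnd_mem_endRing a d⟩
  have hdetZ : a * a + 2 * n = ((D / 4 : ℕ) : ℤ) + ((D % 2 : ℕ) : ℤ) * a := by
    have : 4 * (a * a + 2 * n) = 4 * (((D / 4 : ℕ) : ℤ) + ((D % 2 : ℕ) : ℤ) * a) := by
      rw [hd, hDe] at h4
      rw [hd, ha]
      linear_combination h4
    linarith
  have hT : T * T = ((D / 4 : ℕ) : ℤ) • 1 + ((D % 2 : ℕ) : ℤ) • T := by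
    apply Subtype.ext
    change matrixEnd a β γ d * matrixEnd a β γ d =
      ((D / 4 : ℕ) : ℤ) • 1 + ((D % 2 : ℕ) : ℤ) • matrixEnd a β γ d
    rw [smul_one_add_smul_matrixEnd]
    have hdet : (a : ℂ) * a + β * γ = ((((D / 4 : ℕ) : ℤ) + ((D % 2 : ℕ) : ℤ) * a : ℤ) : ℂ) := by
      rw [← hdetZ]
      have : (β : ℂ) * γ = 2 * n := by exact_mod_cast hn
      push_cast
      rw [this]
    have htr : (a : ℂ) + d = ((D % 2 : ℕ) : ℤ) := by
      rw [hd, ha]; push_cast; ring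
    push_cast at hdet htr ⊢
    apply LinearMap.prod_ext <;> ext <;> simp
    · linear_combination hdet
    · linear_combination γ * htr
    · linear_combination β * htr
    · linear_combination hdet + (d - a) * htr
  let ρ : QuadOrder D →+* endRing p :=
    (QuadraticAlgebra.lift (R := ℤ) (A := endRing p) ⟨T, hT⟩).toRingHom
  have hρω : (ρ omega : Module.End ℂ (ℂ × ℂ)) = matrixEnd a β γ d := by
    change (((0 : ℤ) • (1 : endRing p) + (1 : ℤ) • T : endRing p) : Module.End ℂ (ℂ × ℂ)) = _
    rw [zero_smul, zero_add, one_smul]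
  have hρz : ∀ z, (ρ z : Module.End ℂ (ℂ × ℂ)) = matrixEnd (z.re + z.im * a : ℤ)
      (z.im * β : ℝ) (z.im * γ : ℝ) (z.re + z.im * d : ℤ) := fun z ↦ by
    rw [coe_ringHom_apply, hρω, smul_one_add_smul_matrixEnd]
  have hoffz : ∀ m : ℤ, IsOffDiagonal p (m * β) (m * γ) := by
    intro m
    obtain ⟨β', γ', h', e'⟩ := (sqrtDiscrGroup p).zsmul_mem ⟨β, γ, hoff, rfl⟩ m
    obtain ⟨f1, f2⟩ := hoff.eq_mul_of_add_eq_mul h' (x := m) (by rw [← e', zsmul_eq_mul])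
    rwa [← f1, ← f2]
  have hsa : ∀ z, IsSelfAdjointEnd p (ρ z : Module.End ℂ (ℂ × ℂ)) := fun z ↦ by
    rw [hρz]
    exact (hoffz z.im).isSelfAdjointEnd _ _
  have heig : IsEigenform ρ := fun z ↦ by
    rw [hρz]
    refine ⟨_, oneForm_comp_matrixEnd ?_⟩
    push_cast
    linear_combination (z.im : ℝ) * hsub
  refine ⟨ρ, ⟨?_, hsa, ?_⟩, heig⟩
  · rw [injective_iff_map_eq_zero]
    intro z hz
    have h0 : matrixEnd (z.re + z.im * a : ℤ) (z.im * β : ℝ) (z.im * γ : ℝ) (z.re + z.im * d : ℤ) =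
        matrixEnd 0 0 0 0 := by
      rw [← hρz, hz]
      apply LinearMap.prod_ext <;> ext <;> simp
    obtain ⟨g1, g2, -, -⟩ := matrixEnd_injective h0
    have g2 : z.im = 0 := by
      have : (z.im : ℝ) * β = 0 := by exact_mod_cast g2
      exact_mod_cast (mul_eq_zero.mp this).resolve_right hβ
    have g1 : z.re + z.im * a = 0 := by exact_mod_cast g1
    rw [g2, zero_mul, add_zero] at g1
    ext
    · exact g1
    · exact g2
  · rintro ⟨S, hS⟩ m hm ⟨z, hz⟩
    have hm' : (m : ℂ) ≠ 0 := by exact_mod_cast hm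
    have hz : (ρ z : Module.End ℂ (ℂ × ℂ)) = m • S := congrArg Subtype.val hz
    obtain ⟨a', d', β', γ', hS', hoff', hsub'⟩ := exists_isOffDiagonal (T := S) hS
      (fun v hv w hw ↦ by
        have hpol := hsa z v hv w hw
        rw [hz, LinearMap.smul_apply, LinearMap.smul_apply, polarization_zsmul_left,
          polarization_zsmul_right] at hpol
        exact mul_left_cancel₀ (by exact_mod_cast hm) hpol)
      (by
        obtain ⟨c, hc⟩ := heig z
        refine ⟨(m : ℂ)⁻¹ * c, ?_⟩
        rw [mul_smul, ← hc, hz, ← Int.cast_smul_eq_zsmul ℂ, LinearMap.comp_smul,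
          inv_smul_smul₀ hm'])
    obtain ⟨k, hk⟩ : β' + γ' ∈ AddSubgroup.zmultiples √D := by
      rw [← hp]
      exact ⟨β', γ', hoff', rfl⟩
    simp only [zsmul_eq_mul, ht] at hk
    obtain ⟨f1, f2⟩ := hoff.eq_mul_of_add_eq_mul hoff' hk.symm
    have f3 : a' - k * a + k * d = d' := by
      have : (a' - k * a + k * d : ℝ) = d' := by
        linear_combination k * hsub - hsub' + f1 - f2
      exact_mod_cast this
    refine ⟨⟨a' - k * a, k⟩, Subtype.ext ?_⟩
    change (ρ _ : Module.End ℂ (ℂ × ℂ)) = S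
    rw [hρz, hS', f1, f2]
    simp only [f3, sub_add_cancel]

/-- A pair lies in the eigenform locus of discriminant `D` exactly when `√D` generates its group of
square roots of discriminants. -/
theorem mem_OmegaQPrime_iff {D : ℕ} (hD0 : 0 < D) (hD : D % 4 = 0 ∨ D % 4 = 1)
    {p : PlaneLattice × PlaneLattice} :
    p ∈ OmegaQPrime D ↔ sqrtDiscrGroup p = AddSubgroup.zmultiples √D :=
  ⟨sqrtDiscrGroup_eq_of_mem_OmegaQPrime hD, mem_OmegaQPrime_of_sqrtDiscrGroup_eq hD0 hD⟩

end RealMultiplication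

/-! ### Invariance under `GL⁺(2, ℝ)` -/

theorem IsOffDiagonal.smul {p : PlaneLattice × PlaneLattice} {β γ : ℝ} (h : IsOffDiagonal p β γ)
    (g : GL(2, ℝ)⁺) : IsOffDiagonal (g • p) β γ := by
  have hlin : ∀ (c : ℝ) (w : ℂ), (c : ℂ) * planeLin (g : GL (Fin 2) ℝ) w =
      planeLin (g : GL (Fin 2) ℝ) (c * w) := by
    intro c w
    rw [← Complex.real_smul, ← Complex.real_smul, LinearMap.map_smul]
  refine ⟨?_, ?_, h.sub_int, ?_⟩
  · rintro _ ⟨w, hw, rfl⟩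
    exact ⟨β * w, h.mul_mem_fst w hw, (hlin β w).symm⟩
  · rintro _ ⟨w, hw, rfl⟩
    exact ⟨γ * w, h.mul_mem_snd w hw, (hlin γ w).symm⟩
  · change β * ZLattice.covolume ((g : GL (Fin 2) ℝ) • p.2).carrier =
      2 * γ * ZLattice.covolume ((g : GL (Fin 2) ℝ) • p.1).carrier
    rw [covolume_smul, covolume_smul]
    linear_combination |((g : GL (Fin 2) ℝ) : Matrix (Fin 2) (Fin 2) ℝ).det| * h.adjoint

theorem sqrtDiscrGroup_smul (p : PlaneLattice × PlaneLattice) (g : GL(2, ℝ)⁺) :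
    sqrtDiscrGroup (g • p) = sqrtDiscrGroup p := by
  apply le_antisymm
  · rintro _ ⟨β, γ, h, rfl⟩
    exact ⟨β, γ, by simpa using h.smul g⁻¹, rfl⟩
  · rintro _ ⟨β, γ, h, rfl⟩
    exact ⟨β, γ, h.smul g, rfl⟩

/-! ### Sublattices of the square lattice -/

/-- The lattice spanned by `d + b i` and `a i`. -/
def hermiteLattice (d a b : ℕ) (h : 0 < d * a) : PlaneLattice :=
  Matrix.GeneralLinearGroup.mkOfDetNeZero !![(d : ℝ), 0; (b : ℝ), (a : ℝ)]
    (by rw [Matrix.det_fin_two_of, zero_mul, sub_zero]; exact_mod_cast h.ne') • squareLattice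

theorem mem_hermiteLattice {d a b : ℕ} (h : 0 < d * a) {z : ℂ} :
    z ∈ (hermiteLattice d a b h).carrier ↔
      ∃ m k : ℤ, z = (d * m : ℤ) + (b * m + a * k : ℤ) * Complex.I := by
  rw [hermiteLattice, mem_smul_iff]
  have key : ∀ m k : ℤ, planeLin (Matrix.GeneralLinearGroup.mkOfDetNeZero
      !![(d : ℝ), 0; (b : ℝ), (a : ℝ)]
      (by rw [Matrix.det_fin_two_of, zero_mul, sub_zero]; exact_mod_cast h.ne'))
      (m + k * Complex.I) = (d * m : ℤ) + (b * m + a * k : ℤ) * Complex.I := by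
    intro m k
    rw [planeLin_apply]
    apply Complex.ext <;> simp [Matrix.GeneralLinearGroup.mkOfDetNeZero]
  constructor
  · rintro ⟨w, hw, rfl⟩
    obtain ⟨m, k, rfl⟩ := mem_squareLattice.mp hw
    exact ⟨m, k, key m k⟩
  · rintro ⟨m, k, rfl⟩
    exact ⟨_, mem_squareLattice.mpr ⟨m, k, rfl⟩, key m k⟩

theorem int_add_int_mul_I_inj {x y x' y' : ℤ} :
    (x + y * Complex.I : ℂ) = x' + y' * Complex.I ↔ x = x' ∧ y = y' := by
  rw [Complex.ext_iff]
  simp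

theorem int_mem_hermiteLattice {d a b : ℕ} (h : 0 < d * a) {x y : ℤ} :
    (x + y * Complex.I : ℂ) ∈ (hermiteLattice d a b h).carrier ↔
      ∃ m k : ℤ, x = d * m ∧ y = b * m + a * k := by
  rw [mem_hermiteLattice]
  simp_rw [int_add_int_mul_I_inj]

theorem covolume_hermiteLattice {d a b : ℕ} (h : 0 < d * a) :
    ZLattice.covolume (hermiteLattice d a b h).carrier = (d * a : ℕ) := by
  rw [hermiteLattice, covolume_smul, covolume_squareLattice, mul_one]
  change |Matrix.det !![(d : ℝ), 0; (b : ℝ), (a : ℝ)]| = _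
  rw [Matrix.det_fin_two_of, zero_mul, sub_zero, abs_of_nonneg (by positivity)]
  push_cast
  rfl

theorem hermiteLattice_le {d a b : ℕ} (h : 0 < d * a) :
    (hermiteLattice d a b h).carrier ≤ squareLattice.carrier := by
  intro z hz
  obtain ⟨m, k, rfl⟩ := (mem_hermiteLattice h).mp hz
  exact mem_squareLattice.mpr ⟨_, _, rfl⟩

/-- The integral multiples of `a i` are the purely imaginary elements of the lattice. -/
theorem dvd_of_hermiteLattice_le {d a b d' a' b' : ℕ} {h : 0 < d * a} {h' : 0 < d' * a'}
    (hle : (hermiteLattice d a b h).carrier ≤ (hermiteLattice d' a' b' h').carrier) : a' ∣ a := by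
  have h1 : ((0 : ℤ) + (a : ℤ) * Complex.I : ℂ) ∈ (hermiteLattice d a b h).carrier :=
    (int_mem_hermiteLattice h).mpr ⟨0, 1, by simp, by simp⟩
  obtain ⟨m, k, e1, e2⟩ := (int_mem_hermiteLattice h').mp (hle h1)
  have hd' : (d' : ℤ) ≠ 0 := by exact_mod_cast (Nat.pos_of_mul_pos_right h').ne'
  have hm : m = 0 := (mul_eq_zero.mp e1.symm).resolve_left hd'
  rw [hm, mul_zero, zero_add] at e2
  exact Int.natCast_dvd_natCast.mp ⟨k, e2⟩

theorem hermiteLattice_injective {d a b d' a' b' : ℕ} {h : 0 < d * a} {h' : 0 < d' * a'}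
    (hb : b < a) (hb' : b' < a') (hn : d * a = d' * a')
    (heq : hermiteLattice d a b h = hermiteLattice d' a' b' h') : a = a' ∧ b = b' := by
  have ha : a = a' := Nat.dvd_antisymm (dvd_of_hermiteLattice_le (by rw [heq]))
    (dvd_of_hermiteLattice_le (by rw [heq]))
  subst ha
  have hd : d = d' := Nat.eq_of_mul_eq_mul_right (by omega) hn
  subst hd
  refine ⟨rfl, ?_⟩
  have h1 : ((d : ℤ) + (b : ℤ) * Complex.I : ℂ) ∈ (hermiteLattice d a b h).carrier :=
    (int_mem_hermiteLattice h).mpr ⟨1, 0, by simp, by simp⟩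
  rw [heq] at h1
  obtain ⟨m, k, e1, e2⟩ := (int_mem_hermiteLattice h').mp h1
  have hd : (d : ℤ) ≠ 0 := by exact_mod_cast (Nat.pos_of_mul_pos_right h).ne'
  have hm : m = 1 := (mul_left_cancel₀ hd (by rw [mul_one]; exact e1)).symm
  rw [hm, mul_one] at e2
  have : (b : ℤ) ≡ b' [ZMOD a] := by
    rw [e2]
    simp [Int.ModEq]
  exact Nat.ModEq.eq_of_lt_of_lt (Int.natCast_modEq_iff.mp this) hb hb'

/-- Hermite normal form: for a sublattice `M` of the square lattice, `d` generates the group of real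
parts of elements of `M`, and `a i` generates the group of purely imaginary elements of `M`. -/
theorem exists_eq_hermiteLattice {M : PlaneLattice} (hM : M.carrier ≤ squareLattice.carrier) :
    ∃ (d a b : ℕ) (h : 0 < d * a), b < a ∧ M = hermiteLattice d a b h := by
  obtain ⟨n, hn, -, hmem⟩ := exists_index M squareLattice hM
  -- `Y` consists of the `y` with `y i ∈ M`, and `X` of the real parts of elements of `M`.
  let Y : AddSubgroup ℤ := M.carrier.toAddSubgroup.comap
    ((AddMonoidHom.mulRight Complex.I).comp (Int.castAddHom ℂ))
  let X : AddSubgroup ℤ := (M.carrier.toAddSubgroup.map Complex.reAddGroupHom).comap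
    (Int.castAddHom ℝ)
  have hY : ∀ y : ℤ, y ∈ Y ↔ (y * Complex.I : ℂ) ∈ M.carrier := fun y ↦ Iff.rfl
  have hX : ∀ x : ℤ, x ∈ X ↔ ∃ y : ℤ, (x + y * Complex.I : ℂ) ∈ M.carrier := by
    intro x
    constructor
    · rintro ⟨z, hz, hzx⟩
      obtain ⟨m, k, rfl⟩ := mem_squareLattice.mp (hM hz)
      have hmx : m = x := by simpa using hzx
      exact ⟨k, hmx ▸ hz⟩
    · rintro ⟨y, hy⟩
      exact ⟨_, hy, by simp⟩
  have hgen : ∀ H : AddSubgroup ℤ, (n : ℤ) ∈ H →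
      ∃ a : ℕ, 0 < a ∧ H = AddSubgroup.zmultiples (a : ℤ) := by
    intro H hH
    obtain ⟨a, ha⟩ := Int.subgroup_cyclic H
    rw [← AddSubgroup.zmultiples_eq_closure, ← Int.zmultiples_natAbs] at ha
    refine ⟨a.natAbs, Nat.pos_of_ne_zero fun h0 ↦ ?_, ha⟩
    rw [ha, h0] at hH
    simp at hH
    omega
  obtain ⟨a, ha0, ha⟩ := hgen Y ((hY n).mpr (by
    simpa using hmem Complex.I (mem_squareLattice.mpr ⟨0, 1, by simp⟩)))
  obtain ⟨d, hd0, hd⟩ := hgen X ((hX n).mpr ⟨0, by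
    simpa using hmem 1 (mem_squareLattice.mpr ⟨1, 0, by simp⟩)⟩)
  have hYa : ∀ y : ℤ, (y * Complex.I : ℂ) ∈ M.carrier ↔ (a : ℤ) ∣ y := by
    intro y
    rw [← hY, ha, Int.mem_zmultiples_iff]
  obtain ⟨y₀, hy₀⟩ := (hX d).mp (by rw [hd]; exact AddSubgroup.mem_zmultiples _)
  have ha0' : (a : ℤ) ≠ 0 := by exact_mod_cast ha0.ne'
  obtain ⟨b, hb⟩ := Int.eq_ofNat_of_zero_le (Int.emod_nonneg y₀ ha0')
  have hba : b < a := by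
    have := Int.emod_lt_of_pos y₀ (by exact_mod_cast ha0 : (0 : ℤ) < a)
    rw [hb] at this
    exact_mod_cast this
  have hdiv : (a : ℤ) ∣ y₀ - b := by
    rw [← hb]
    exact Int.dvd_self_sub_emod
  have hdb : ((d : ℤ) + (b : ℤ) * Complex.I : ℂ) ∈ M.carrier := by
    have := M.carrier.sub_mem hy₀ ((hYa _).mpr hdiv)
    convert this using 1
    push_cast
    ring
  refine ⟨d, a, b, Nat.mul_pos hd0 ha0, hba, ?_⟩
  ext z
  constructor
  · intro hz
    obtain ⟨x, y, rfl⟩ := mem_squareLattice.mp (hM hz)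
    have hx : x ∈ X := (hX x).mpr ⟨y, hz⟩
    rw [hd, Int.mem_zmultiples_iff] at hx
    obtain ⟨m, rfl⟩ := hx
    have h1 := M.carrier.sub_mem hz (M.carrier.smul_mem m hdb)
    have h2 : ((y - b * m : ℤ) * Complex.I : ℂ) ∈ M.carrier := by
      convert h1 using 1
      push_cast
      rw [zsmul_eq_mul]
      ring
    obtain ⟨k, hk⟩ := (hYa _).mp h2
    exact (int_mem_hermiteLattice _).mpr ⟨m, k, rfl, by linarith⟩
  · intro hz
    obtain ⟨m, k, rfl⟩ := (mem_hermiteLattice _).mp hz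
    have h1 := M.carrier.add_mem (M.carrier.smul_mem m hdb)
      (M.carrier.smul_mem k ((hYa a).mpr dvd_rfl))
    convert h1 using 1
    push_cast
    rw [zsmul_eq_mul, zsmul_eq_mul]
    ring

/-- The sublattices of index `n` of the square lattice, whose covolume is `1`. -/
def sublattices (n : ℕ) : Set PlaneLattice :=
  {M | M.carrier ≤ squareLattice.carrier ∧ ZLattice.covolume M.carrier = n}

/-- There are `a` lattices spanned by `d + b i` and `a i` with `0 ≤ b < a`, for each divisor
`a = n / d` of `n`. -/
theorem ncard_sublattices {n : ℕ} (hn : 0 < n) :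
    (sublattices n).ncard = ArithmeticFunction.sigma 1 n := by
  have hcard : ((n.divisors.sigma fun a ↦ Finset.range a : Finset (Σ _ : ℕ, ℕ)) :
      Set (Σ _ : ℕ, ℕ)).ncard = ArithmeticFunction.sigma 1 n := by
    rw [Set.ncard_coe_finset, Finset.card_sigma, ArithmeticFunction.sigma_one_apply]
    simp
  have hmul : ∀ x ∈ ((n.divisors.sigma fun a ↦ Finset.range a : Finset (Σ _ : ℕ, ℕ)) :
      Set (Σ _ : ℕ, ℕ)), n / x.1 * x.1 = n ∧ x.2 < x.1 := by
    rintro x hx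
    rw [Finset.mem_coe, Finset.mem_sigma, Nat.mem_divisors, Finset.mem_range] at hx
    exact ⟨Nat.div_mul_cancel hx.1.1, hx.2⟩
  rw [← hcard]
  refine (Set.ncard_congr (fun x hx ↦ hermiteLattice (n / x.1) x.1 x.2
    (by rw [(hmul x hx).1]; exact hn)) ?_ ?_ ?_).symm
  · intro x hx
    exact ⟨hermiteLattice_le _, by rw [covolume_hermiteLattice, (hmul x hx).1]⟩
  · rintro ⟨a, b⟩ ⟨a', b'⟩ hx hx' heq
    obtain ⟨rfl, rfl⟩ := hermiteLattice_injective (hmul _ hx).2 (hmul _ hx').2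
      ((hmul _ hx).1.trans (hmul _ hx').1.symm) heq
    rfl
  · rintro M ⟨hM, hcov⟩
    obtain ⟨d, a, b, h, hba, rfl⟩ := exists_eq_hermiteLattice hM
    rw [covolume_hermiteLattice] at hcov
    have hda : d * a = n := by exact_mod_cast hcov
    have ha : 0 < a := by omega
    have hd : n / a = d := by rw [← hda, Nat.mul_div_cancel _ ha]
    refine ⟨⟨a, b⟩, ?_, ?_⟩
    · rw [Finset.mem_coe, Finset.mem_sigma, Nat.mem_divisors, Finset.mem_range]
      exact ⟨⟨⟨d, by rw [← hda, mul_comm]⟩, hn.ne'⟩, hba⟩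
    · simp only [hd]

theorem finite_sublattices {n : ℕ} (hn : 0 < n) : (sublattices n).Finite := by
  refine Set.finite_of_ncard_pos ?_
  rw [ncard_sublattices hn]
  exact ArithmeticFunction.sigma_pos 1 n hn.ne'

/-! ### Counting pairs of lattices with an endomorphism of given discriminant -/

/-- For positive `β` and `γ`, the condition on `M` says that `γ M` is a sublattice of index
`β γ / 2` of the square lattice. -/
theorem isOffDiagonal_squareLattice_iff {β γ : ℝ} (hγ : 0 < γ) (he : ∃ e : ℤ, β - γ = e)
    {n : ℕ} (hn : β * γ = 2 * n) (M : PlaneLattice) :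
    IsOffDiagonal (M, squareLattice) β γ ↔
      (scalarGL (Units.mk0 (γ : ℂ) (Complex.ofReal_ne_zero.mpr hγ.ne')) : GL (Fin 2) ℝ) • M ∈
        sublattices n := by
  set c : ℂˣ := Units.mk0 (γ : ℂ) (Complex.ofReal_ne_zero.mpr hγ.ne') with hc
  have hcov : ZLattice.covolume ((scalarGL c : GL (Fin 2) ℝ) • M).carrier =
      γ ^ 2 * ZLattice.covolume M.carrier := by
    have hdet : (((scalarGL c : GL (Fin 2) ℝ) : Matrix (Fin 2) (Fin 2) ℝ)).det = γ ^ 2 := by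
      change Matrix.det !![(c : ℂ).re, -(c : ℂ).im; (c : ℂ).im, (c : ℂ).re] = _
      rw [Matrix.det_fin_two_of]
      simp [c, sq]
    rw [covolume_smul, hdet, abs_of_nonneg (sq_nonneg γ)]
  have hmem : ∀ z, z ∈ ((scalarGL c : GL (Fin 2) ℝ) • M).carrier ↔
      ∃ w ∈ M.carrier, (γ : ℂ) * w = z := by
    intro z
    simp_rw [mem_smul_iff, planeLin_scalarGL]
    rfl
  have hγ' : (γ : ℂ) ≠ 0 := Complex.ofReal_ne_zero.mpr hγ.ne'
  constructor
  · intro h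
    have hadj := h.adjoint
    rw [covolume_squareLattice] at hadj
    refine ⟨?_, ?_⟩
    · intro z hz
      obtain ⟨w, hw, rfl⟩ := (hmem z).mp hz
      exact h.mul_mem_snd w hw
    · rw [hcov]
      linear_combination (-γ / 2) * hadj + hn / 2
  · rintro ⟨hle, hcovn⟩
    rw [hcov] at hcovn
    refine ⟨?_, ?_, he, ?_⟩
    · intro z hz
      obtain ⟨m, -, hm, hidx⟩ := exists_index _ _ hle
      rw [hcov, hcovn, covolume_squareLattice, mul_one] at hm
      obtain ⟨w, hw, hwz⟩ := (hmem _).mp (hidx z hz)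
      have hm : (m : ℂ) = n := by exact_mod_cast hm.symm
      have hn' : (β : ℂ) * γ = 2 * n := by exact_mod_cast hn
      have : (β : ℂ) * z = w + w := by
        refine mul_left_cancel₀ hγ' ?_
        rw [hm] at hwz
        linear_combination z * hn' - 2 * hwz
      rw [this]
      exact M.carrier.add_mem hw hw
    · exact fun z hz ↦ hle ((hmem _).mpr ⟨z, hz, rfl⟩)
    · rw [covolume_squareLattice]
      refine mul_right_cancel₀ hγ.ne' ?_
      linear_combination hn - 2 * hcovn

theorem finite_and_ncard_isOffDiagonal {β γ : ℝ} (hγ : 0 < γ) (he : ∃ e : ℤ, β - γ = e)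
    {n : ℕ} (hn0 : 0 < n) (hn : β * γ = 2 * n) :
    {M | IsOffDiagonal (M, squareLattice) β γ}.Finite ∧
      {M | IsOffDiagonal (M, squareLattice) β γ}.ncard = ArithmeticFunction.sigma 1 n := by
  let σ := MulAction.toPerm (α := GL (Fin 2) ℝ) (β := PlaneLattice)
    (scalarGL (Units.mk0 (γ : ℂ) (Complex.ofReal_ne_zero.mpr hγ.ne')))
  have hset : {M | IsOffDiagonal (M, squareLattice) β γ} = σ ⁻¹' sublattices n :=
    Set.ext fun M ↦ isOffDiagonal_squareLattice_iff hγ he hn M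
  rw [hset]
  refine ⟨(finite_sublattices hn0).preimage σ.injective.injOn, ?_⟩
  rw [Set.ncard_preimage_of_injective_subset_range σ.injective
    (by rw [σ.surjective.range_eq]; exact Set.subset_univ _), ncard_sublattices hn0]

/-- The lattices `M` for which the pair of `M` and the square lattice has a self-adjoint
endomorphism of discriminant `D` with the eigenform `dz₁ + dz₂`. -/
def discrFibre (D : ℕ) : Set PlaneLattice :=
  {M | √D ∈ sqrtDiscrGroup (M, squareLattice)}

/-- The integers `e` with `e² < D` and `e² ≡ D` modulo `8`. -/
def discrIndices (D : ℕ) : Finset ℤ :=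
  (Finset.Icc (-(D : ℤ)) (D : ℤ)).filter fun e : ℤ ↦ e ^ 2 < (D : ℤ) ∧ e ^ 2 ≡ (D : ℤ) [ZMOD 8]

theorem mem_discrIndices {D : ℕ} {e : ℤ} :
    e ∈ discrIndices D ↔ e ^ 2 < D ∧ e ^ 2 ≡ D [ZMOD 8] := by
  rw [discrIndices, Finset.mem_filter, Finset.mem_Icc]
  refine ⟨fun h ↦ h.2, fun h ↦ ⟨⟨?_, ?_⟩, h⟩⟩ <;>
    nlinarith [h.1, sq_nonneg (e - 1), sq_nonneg (e + 1)]

/-- The off-diagonal entries `β` and `γ` of an endomorphism with `β + γ = √D` are positive, and they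
are determined by the integer `e = β - γ`. -/
theorem discrFibre_eq_biUnion {D : ℕ} (hD : 0 < D) :
    discrFibre D = ⋃ e ∈ (discrIndices D : Set ℤ),
      {M | IsOffDiagonal (M, squareLattice) ((√D + e) / 2) ((√D - e) / 2)} := by
  have hpos : 0 < √(D : ℝ) := Real.sqrt_pos.mpr (by exact_mod_cast hD)
  ext M
  simp only [Set.mem_iUnion, Finset.mem_coe, exists_prop]
  constructor
  · rintro ⟨β, γ, h, ht⟩
    obtain ⟨e, n, he, hn, hsq⟩ := h.exists_sq_eq
    have hc := covolume_pos M
    have hadj := h.adjoint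
    rw [covolume_squareLattice, mul_one] at hadj
    -- Self-adjointness makes `β` a positive multiple of `γ`, and their sum is positive.
    have hγ : 0 < γ := by
      have h1 : γ * (1 + 2 * ZLattice.covolume M.carrier) = √D := by rw [ht, hadj]; ring
      exact (pos_iff_pos_of_mul_pos (by rw [h1]; exact hpos)).mpr (by positivity)
    have hβ : 0 < β := by rw [hadj]; positivity
    have hn0 : 0 < n := by
      have : (0 : ℝ) < 2 * n := by rw [← hn]; positivity
      exact_mod_cast (by linarith : (0 : ℝ) < n)
    have hDe : (D : ℤ) = e ^ 2 + 8 * n := by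
      rw [← ht, Real.sq_sqrt (Nat.cast_nonneg D)] at hsq
      exact_mod_cast hsq
    refine ⟨e, mem_discrIndices.mpr ⟨by omega, ?_⟩, ?_⟩
    · rw [hDe]
      simp [Int.ModEq]
    · have h1 : (√D + e) / 2 = β := by linarith
      have h2 : (√D - e) / 2 = γ := by linarith
      rwa [Set.mem_ofPred_eq, h1, h2]
  · rintro ⟨e, -, h⟩
    exact ⟨_, _, h, by ring⟩

/-- For each `e`, the lattices `M` in question are the multiples by `1 / γ` of the sublattices of
index `(D - e²) / 8` of the square lattice. -/
theorem finite_and_ncard_discrFibre {D : ℕ} (hD : 0 < D) :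
    (discrFibre D).Finite ∧ (discrFibre D).ncard =
      ∑ e ∈ discrIndices D, ArithmeticFunction.sigma 1 (((D : ℤ) - e ^ 2) / 8).toNat := by
  have hs : ∀ e ∈ discrIndices D,
      {M | IsOffDiagonal (M, squareLattice) ((√D + e) / 2) ((√D - e) / 2)}.Finite ∧
      {M | IsOffDiagonal (M, squareLattice) ((√D + e) / 2) ((√D - e) / 2)}.ncard =
        ArithmeticFunction.sigma 1 (((D : ℤ) - e ^ 2) / 8).toNat := by
    intro e he
    obtain ⟨h1, h2⟩ := mem_discrIndices.mp he
    obtain ⟨m, hm⟩ := h2.dvd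
    have hm0 : 0 < m := by omega
    lift m to ℕ using hm0.le
    have hDe : (D : ℤ) = e ^ 2 + 8 * m := by linarith
    have hn : (((D : ℤ) - e ^ 2) / 8).toNat = m := by
      rw [hm, Int.mul_ediv_cancel_left _ (by norm_num), Int.toNat_natCast]
    rw [hn]
    refine finite_and_ncard_isOffDiagonal ?_ ⟨e, by ring⟩ (by exact_mod_cast hm0) ?_
    · have : (e : ℝ) < √D := Real.lt_sqrt_of_sq_lt (by exact_mod_cast h1)
      linarith
    · have hD' : (D : ℝ) = e ^ 2 + 8 * m := by exact_mod_cast hDe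
      have hsq := Real.sq_sqrt (Nat.cast_nonneg (α := ℝ) D)
      linear_combination (hsq + hD') / 4
  rw [discrFibre_eq_biUnion hD]
  refine ⟨(discrIndices D).finite_toSet.biUnion fun e he ↦ (hs e he).1, ?_⟩
  rw [(discrIndices D).finite_toSet.ncard_biUnion (fun e he ↦ (hs e he).1), finsum_mem_coe_finset]
  · exact Finset.sum_congr rfl fun e he ↦ (hs e he).2
  · intro e _ e' _ hne
    rw [Function.onFun, Set.disjoint_left]
    intro M h h'
    have := (IsOffDiagonal.eq_mul_of_add_eq_mul h h' (x := 1) (by ring)).1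
    apply hne
    have : (e : ℝ) = e' := by linarith
    exact_mod_cast this

/-- The lattices `M` for which the pair of `M` and the square lattice lies in the eigenform
locus. -/
def eigenformFibre (D : ℕ) : Set PlaneLattice :=
  {M | (M, squareLattice) ∈ OmegaQPrime D}

theorem smul_mem_OmegaQPrime {D : ℕ} (hD0 : 0 < D) (hD : D % 4 = 0 ∨ D % 4 = 1)
    {p : PlaneLattice × PlaneLattice} (hp : p ∈ OmegaQPrime D) (g : GL(2, ℝ)⁺) :
    g • p ∈ OmegaQPrime D := by
  rw [mem_OmegaQPrime_iff hD0 hD] at hp ⊢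
  rw [sqrtDiscrGroup_smul, hp]

/-- Each component contributes `-1 / 6` times the size of its fibre over the square lattice, and
these fibres partition the fibre of the eigenform locus. -/
theorem qPrimeFinite_and_chiQPrime {D : ℕ} (hD0 : 0 < D) (hD : D % 4 = 0 ∨ D % 4 = 1)
    (hfin : (eigenformFibre D).Finite) :
    QPrimeFinite D ∧ chiQPrime D = -(1 / 6) * (eigenformFibre D).ncard := by
  have hmem : ∀ M o, M ∈ orbitFibre o → (o ∈ components D ↔ M ∈ eigenformFibre D) := by
    rintro M o rfl
    constructor
    · rintro ⟨p, hp, hpo⟩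
      obtain ⟨g, hg⟩ := Quotient.exact hpo
      have := smul_mem_OmegaQPrime hD0 hD hp g⁻¹
      rw [← hg, inv_smul_smul] at this
      exact this
    · exact fun hM ↦ ⟨_, hM, rfl⟩
  have hunion : eigenformFibre D = ⋃ o ∈ components D, orbitFibre o := by
    ext M
    simp only [Set.mem_iUnion, exists_prop]
    constructor
    · exact fun hM ↦ ⟨_, (hmem M _ rfl).mpr hM, rfl⟩
    · rintro ⟨o, ho, hM⟩
      exact (hmem M o hM).mp ho
  have hcomp : (components D).Finite := by
    refine (hfin.image fun M ↦ Quotient.mk (MulAction.orbitRel GL(2, ℝ)⁺ _)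
      (M, squareLattice)).subset fun o ho ↦ ?_
    obtain ⟨M, hM⟩ := exists_mem_orbitFibre o
    exact ⟨M, (hmem M o hM).mp ho, hM⟩
  have hfib : ∀ o ∈ components D, (orbitFibre o).Finite := by
    intro o ho
    refine hfin.subset ?_
    rw [hunion]
    exact Set.subset_biUnion_of_mem ho
  refine ⟨⟨hcomp, fun o ho ↦ (hasFiniteArea_and_orbifoldEulerChar o (hfib o ho)).1⟩, ?_⟩
  rw [hunion, hcomp.ncard_biUnion hfib, chiQPrime,
    finsum_mem_congr rfl fun o ho ↦ (hasFiniteArea_and_orbifoldEulerChar o (hfib o ho)).2,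
    finsum_mem_eq_finite_toFinset_sum _ hcomp, finsum_mem_eq_finite_toFinset_sum _ hcomp,
    ← Finset.mul_sum, Nat.cast_sum]
  intro o _ o' _ hne
  rw [Function.onFun, Set.disjoint_left]
  intro M h h'
  exact hne (h.symm.trans h')

/-- Odd squares are `1` modulo `8`. -/
theorem IsOneTwoDiscriminant.of_mul_sq {D r : ℕ} (hr : r % 2 = 1)
    (h : IsOneTwoDiscriminant (r ^ 2 * D)) : IsOneTwoDiscriminant D := by
  obtain ⟨k, rfl⟩ : ∃ k, r = 2 * k + 1 := ⟨r / 2, by omega⟩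
  obtain ⟨j, hj⟩ := Nat.even_mul_succ_self k
  have : (2 * k + 1) ^ 2 * D = 8 * (j * D) + D := by
    have : (2 * k + 1) ^ 2 = 8 * j + 1 := by
      have : (2 * k + 1) ^ 2 = 4 * (k * (k + 1)) + 1 := by ring
      omega
    rw [this]
    ring
  unfold IsOneTwoDiscriminant at *
  omega

/-- The discriminants of the orders that contain the order of discriminant `f² D₀` and that are `0`,
`1` or `4` modulo `8` are the `r² D₀` with `r ∣ f`. -/
theorem IsOneTwoPrimitive.exists_eq_sq_mul {D₀ D f s : ℕ} (hD₀ : IsOneTwoPrimitive D₀)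
    (hf : 0 < f) (hD : IsOneTwoDiscriminant D) (h : f ^ 2 * D₀ = s ^ 2 * D) :
    ∃ r, r ∣ f ∧ D = r ^ 2 * D₀ := by
  obtain ⟨h9, hD₀', hprim⟩ := hD₀
  obtain ⟨g, f₁, s₁, hg, hcop, rfl, rfl⟩ : ∃ g f₁ s₁, 0 < g ∧ Nat.Coprime f₁ s₁ ∧ f = f₁ * g ∧
      s = s₁ * g := Nat.exists_coprime' (Nat.gcd_pos_of_pos_left s hf)
  have h1 : f₁ ^ 2 * D₀ = s₁ ^ 2 * D := by
    refine Nat.eq_of_mul_eq_mul_left (pow_pos hg 2) ?_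
    linear_combination h
  have hcop2 : Nat.Coprime (s₁ ^ 2) (f₁ ^ 2) := hcop.symm.pow 2 2
  -- The square of `s₁` divides `D₀`, so primitivity leaves only `s₁ = 1`.
  obtain ⟨D₁, rfl⟩ : s₁ ^ 2 ∣ D₀ := hcop2.dvd_of_dvd_mul_left ⟨D, h1⟩
  have hs₁ : 0 < s₁ := by
    rcases Nat.eq_zero_or_pos s₁ with rfl | hs
    · simp at h9
    · exact hs
  have h2 : D = f₁ ^ 2 * D₁ := by
    refine Nat.eq_of_mul_eq_mul_left (pow_pos hs₁ 2) ?_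
    linear_combination -h1
  have hD₁ : s₁ = 1 := by
    by_contra hne
    refine hprim ⟨s₁, D₁, by omega, rfl, ?_⟩
    rcases Nat.mod_two_eq_zero_or_one s₁ with hpar | hpar
    · refine IsOneTwoDiscriminant.of_mul_sq (r := f₁) ?_ (h2 ▸ hD)
      by_contra hf₁
      have := Nat.dvd_gcd (Nat.dvd_of_mod_eq_zero (by omega : f₁ % 2 = 0))
        (Nat.dvd_of_mod_eq_zero hpar)
      rw [hcop.gcd_eq_one] at this
      omega
    · exact IsOneTwoDiscriminant.of_mul_sq hpar hD₀'
  subst hD₁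
  exact ⟨f₁, dvd_mul_right _ _, by rw [h2, one_pow, one_mul]⟩

theorem sqrt_sq_mul (r D : ℕ) : √((r ^ 2 * D : ℕ) : ℝ) = r * √D := by
  rw [Nat.cast_mul, Nat.cast_pow, Real.sqrt_mul (by positivity), Real.sqrt_sq (Nat.cast_nonneg r)]

theorem sq_mul_mod_four {D r : ℕ} (hD : IsOneTwoDiscriminant D) :
    r ^ 2 * D % 4 = 0 ∨ r ^ 2 * D % 4 = 1 := by
  have h1 : r ^ 2 % 4 = 0 ∨ r ^ 2 % 4 = 1 := by
    have : r % 4 < 4 := Nat.mod_lt _ (by norm_num)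
    rw [Nat.pow_mod]
    interval_cases r % 4 <;> simp
  have h2 : D % 4 = 0 ∨ D % 4 = 1 := by
    unfold IsOneTwoDiscriminant at hD
    omega
  rw [Nat.mul_mod]
  rcases h1 with h1 | h1 <;> rcases h2 with h2 | h2 <;> simp [h1, h2]

/-- An endomorphism of discriminant `f² D₀` is contained in a unique maximal real multiplication,
and its order has discriminant `r² D₀` for some `r ∣ f`. -/
theorem discrFibre_eq_biUnion_eigenformFibre {D₀ f : ℕ} (hD₀ : IsOneTwoPrimitive D₀) (hf : 0 < f) :
    discrFibre (f ^ 2 * D₀) =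
      ⋃ r ∈ (f.divisors : Set ℕ), eigenformFibre (r ^ 2 * D₀) := by
  have hD₀pos : 0 < D₀ := by have := hD₀.1; omega
  have hsqrt : 0 < √(D₀ : ℝ) := Real.sqrt_pos.mpr (by exact_mod_cast hD₀pos)
  have hiff : ∀ r ∈ f.divisors, ∀ M, M ∈ eigenformFibre (r ^ 2 * D₀) ↔
      sqrtDiscrGroup (M, squareLattice) = AddSubgroup.zmultiples √((r ^ 2 * D₀ : ℕ) : ℝ) :=
    fun r hr M ↦ mem_OmegaQPrime_iff (Nat.mul_pos (pow_pos (Nat.pos_of_mem_divisors hr) 2) hD₀pos)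
      (sq_mul_mod_four hD₀.2.1)
  ext M
  simp only [Set.mem_iUnion, Finset.mem_coe, exists_prop]
  constructor
  · intro hM
    change √_ ∈ sqrtDiscrGroup _ at hM
    obtain ⟨t, ht0, ht⟩ := exists_sqrtDiscrGroup_eq_zmultiples (M, squareLattice)
    obtain ⟨β, γ, hoff, htβ⟩ : t ∈ sqrtDiscrGroup (M, squareLattice) := by
      rw [ht]; exact AddSubgroup.mem_zmultiples t
    obtain ⟨e, n, -, -, hsq⟩ := hoff.exists_sq_eq
    rw [← htβ] at hsq
    have htsqrt : t = √((e.natAbs ^ 2 + 8 * n : ℕ) : ℝ) := by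
      rw [← Real.sqrt_sq ht0, hsq]
      congr 1
      push_cast
      rw [Nat.cast_natAbs, Int.cast_abs, sq_abs]
    rw [ht] at hM
    obtain ⟨k, hk⟩ := hM
    have hk2 : f ^ 2 * D₀ = k.natAbs ^ 2 * (e.natAbs ^ 2 + 8 * n) := by
      have h1 := congrArg (· ^ 2) hk
      simp only [zsmul_eq_mul, mul_pow, hsq] at h1
      rw [Real.sq_sqrt (Nat.cast_nonneg _)] at h1
      have h2 : k ^ 2 * (e ^ 2 + 8 * n) = ((f ^ 2 * D₀ : ℕ) : ℤ) := by exact_mod_cast h1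
      zify
      rw [sq_abs, sq_abs, h2]
      push_cast
      rfl
    have hdisc : IsOneTwoDiscriminant (e.natAbs ^ 2 + 8 * n) := by
      have : e.natAbs ^ 2 % 8 = 0 ∨ e.natAbs ^ 2 % 8 = 1 ∨ e.natAbs ^ 2 % 8 = 4 := by
        have : e.natAbs % 8 < 8 := Nat.mod_lt _ (by norm_num)
        rw [Nat.pow_mod]
        interval_cases e.natAbs % 8 <;> simp
      unfold IsOneTwoDiscriminant
      omega
    obtain ⟨r, hr, hr'⟩ := hD₀.exists_eq_sq_mul hf hdisc hk2
    have hrf : r ∈ f.divisors := Nat.mem_divisors.mpr ⟨hr, hf.ne'⟩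
    exact ⟨r, hrf, (hiff r hrf M).mpr (by rw [ht, htsqrt, hr'])⟩
  · rintro ⟨r, hr, hM⟩
    rw [hiff r hr] at hM
    obtain ⟨k, rfl⟩ := Nat.dvd_of_mem_divisors hr
    change √_ ∈ sqrtDiscrGroup _
    rw [hM, sqrt_sq_mul, sqrt_sq_mul]
    exact ⟨k, by simp; ring⟩

theorem pairwiseDisjoint_eigenformFibre {D₀ f : ℕ} (hD₀ : IsOneTwoPrimitive D₀) :
    (f.divisors : Set ℕ).PairwiseDisjoint fun r ↦ eigenformFibre (r ^ 2 * D₀) := by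
  have hD₀pos : 0 < D₀ := by have := hD₀.1; omega
  have hsqrt : √(D₀ : ℝ) ≠ 0 := (Real.sqrt_pos.mpr (by exact_mod_cast hD₀pos)).ne'
  have hdvd : ∀ r r' : ℕ, AddSubgroup.zmultiples √((r ^ 2 * D₀ : ℕ) : ℝ) =
      AddSubgroup.zmultiples √((r' ^ 2 * D₀ : ℕ) : ℝ) → r' ∣ r := by
    intro r r' h
    obtain ⟨k, hk⟩ : √((r ^ 2 * D₀ : ℕ) : ℝ) ∈
        AddSubgroup.zmultiples √((r' ^ 2 * D₀ : ℕ) : ℝ) := by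
      rw [← h]; exact AddSubgroup.mem_zmultiples _
    simp only [sqrt_sq_mul, zsmul_eq_mul, ← mul_assoc] at hk
    have hk := mul_right_cancel₀ hsqrt hk
    have hk : k * r' = (r : ℤ) := by exact_mod_cast hk
    exact Int.natCast_dvd_natCast.mp ⟨k, by rw [← hk, mul_comm]⟩
  intro r hr r' hr' hne
  rw [Function.onFun, Set.disjoint_left]
  intro M h h'
  have hpos : ∀ r ∈ f.divisors, 0 < r ^ 2 * D₀ := fun r hr ↦
    Nat.mul_pos (pow_pos (Nat.pos_of_mem_divisors hr) 2) hD₀pos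
  have h1 := (mem_OmegaQPrime_iff (hpos r hr) (sq_mul_mod_four hD₀.2.1)).mp h
  have h2 := (mem_OmegaQPrime_iff (hpos r' hr') (sq_mul_mod_four hD₀.2.1)).mp h'
  have h12 := h1.symm.trans h2
  exact hne (Nat.dvd_antisymm (hdvd _ _ h12.symm) (hdvd _ _ h12))

end PrymEigenform

end

theorem mainTheorem6 (D₀ : ℕ) (hD₀ : PrymEigenform.IsOneTwoPrimitive D₀) (f : ℕ) (hf : 1 ≤ f) :
    (∀ r ∈ f.divisors, PrymEigenform.QPrimeFinite (r ^ 2 * D₀)) ∧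
    ∑ r ∈ f.divisors, PrymEigenform.chiQPrime (r ^ 2 * D₀) =
      -(1 / 6 : ℝ) * ∑ e ∈ (Finset.Icc (-((f ^ 2 * D₀ : ℕ) : ℤ)) ((f ^ 2 * D₀ : ℕ) : ℤ)).filter
          (fun e : ℤ => e ^ 2 < ((f ^ 2 * D₀ : ℕ) : ℤ) ∧ e ^ 2 ≡ ((f ^ 2 * D₀ : ℕ) : ℤ) [ZMOD 8]),
        ((ArithmeticFunction.sigma 1 ((((f ^ 2 * D₀ : ℕ) : ℤ) - e ^ 2) / 8).toNat : ℕ) : ℝ) := by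
  have hD₀pos : 0 < D₀ := by have := hD₀.1; omega
  have hfin := PrymEigenform.finite_and_ncard_discrFibre (D := f ^ 2 * D₀)
    (Nat.mul_pos (pow_pos hf 2) hD₀pos)
  rw [PrymEigenform.discrFibre_eq_biUnion_eigenformFibre hD₀ hf] at hfin
  have hfib : ∀ r ∈ f.divisors, (PrymEigenform.eigenformFibre (r ^ 2 * D₀)).Finite :=
    fun r hr ↦ hfin.1.subset
      (Set.subset_biUnion_of_mem (u := fun r ↦ PrymEigenform.eigenformFibre (r ^ 2 * D₀)) hr)
  have hcomp := fun r hr ↦ PrymEigenform.qPrimeFinite_and_chiQPrime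
    (Nat.mul_pos (pow_pos (Nat.pos_of_mem_divisors hr) 2) hD₀pos)
    (PrymEigenform.sq_mul_mod_four hD₀.2.1) (hfib r hr)
  refine ⟨fun r hr ↦ (hcomp r hr).1, ?_⟩
  have hcard := hfin.2
  rw [f.divisors.finite_toSet.ncard_biUnion hfib
    (PrymEigenform.pairwiseDisjoint_eigenformFibre hD₀), finsum_mem_coe_finset] at hcard
  rw [Finset.sum_congr rfl fun r hr ↦ (hcomp r hr).2, ← Finset.mul_sum, ← Nat.cast_sum, hcard,
    Nat.cast_sum]
  rfl
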